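/- Let $n\ge 1$ be an integer, $\mu>0$, $\beta>2$, and put $p_G(n)=\frac{n+1}{n-1}$ for $n\ge 2$, $p_G(1)=\infty$. Let $1<p<\infty$ with $p\le p_G(n)$. Let $f\in H^1(\mathbf R^n)$ and $g\in L^2(\mathbf R^n)$ be real-valued and non-negative, neither of them vanishing identically (almost everywhere), both supported in $\{x:|x|\le 1\}$. For $\varepsilon>0$ consider the Cauchy problem $$u_{tt}-\Delta u+\frac{\mu}{(1+|x|)^{\beta}}u_t=|u_t|^p,\qquad u(0,x)=\varepsilon f(x),\quad u_t(0,x)=\varepsilon g(x).$$ An energy solution on $[0,T)$, $0<T<\infty$, is a function $u\in C([0,T),H^1(\mathbf R^n))\cap C^1([0,T),L^2(\mathbf R^n))$ with $u_t\in L^p_{loc}([0,T)\times\mathbf R^n)$ (that is, $|u_t|^p$ is integrable over every compact subset of $[0,T)\times\mathbf R^n$), with $u(0)=\varepsilon f$, $u_t(0)=\varepsilon g$, and such that $$\varepsilon\int_{\mathbf R^n} g\,\Psi(0,x)\,dx+\varepsilon\int_{\mathbf R^n}\frac{\mu}{(1+|x|)^\beta}f\,\Psi(0,x)\,dx+\int_0^T\!\!\int_{\mathbf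 R^n}|u_t|^p\,\Psi\,dx\,dt$$ $$=-\int_0^T\!\!\int_{\mathbf R^n}u_t\Psi_t\,dx\,dt+\int_0^T\!\!\int_{\mathbf R^n}\nabla u\cdot\nabla\Psi\,dx\,dt-\int_0^T\!\!\int_{\mathbf R^n}\frac{\mu}{(1+|x|)^\beta}u\,\Psi_t\,dx\,dt$$ for every $\Psi\in C_0^\infty([0,T)\times\mathbf R^n)$ (which need not vanish at $t=0$). Theorem. There exist constants $\varepsilon_0>0$ and $C>0$, depending only on $f,g,n,p,\mu,\beta$, such that for every $0<\varepsilon\le\varepsilon_0$ and every $T\in(0,\infty)$: if there is an energy solution $u$ on $[0,T)$ with $\operatorname{supp}u\subset\{(x,t)\in\mathbf R^n\times[0,T):|x|\le t+1\}$, then $$T\le C\,\varepsilon^{-\left(\frac1{p-1}-\frac{n-1}{2}\right)^{-1}}\quad\text{if }p<p_G(n),\qquad T\le\exp\left(C\varepsilon^{-(p-1)}\right)\quad\text{if }p=p_G(n).$$ -/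

import Mathlib

open MeasureTheory
open scoped ContDiff

/-- The space `ℝⁿ` with its Euclidean norm. -/
abbrev Rn (n : ℕ) : Type := EuclideanSpace ℝ (Fin n)

/-- The real Lebesgue space `L²(ℝⁿ)`. -/
abbrev L2 (n : ℕ) : Type := Lp ℝ 2 (volume : Measure (Rn n))

/-- The space `L²(ℝⁿ; ℝⁿ)` of square integrable vector fields. -/
abbrev L2Vec (n : ℕ) : Type := Lp (Rn n) 2 (volume : Measure (Rn n))

/-- `G` is the weak (distributional) gradient of `w`:
`∫ w ∇φ dx = - ∫ φ G dx` for every test function `φ`. -/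
def IsWeakGradient {n : ℕ} (w : Rn n → ℝ) (G : Rn n → Rn n) : Prop :=
  ∀ φ : Rn n → ℝ, ContDiff ℝ ∞ φ → HasCompactSupport φ →
    ∫ x, w x • gradient φ x = - ∫ x, φ x • G x

lemma integrable_smul_gradient {n : ℕ} (w : L2 n) {φ : Rn n → ℝ} (hφ : ContDiff ℝ ∞ φ)
    (hc : HasCompactSupport φ) : Integrable (fun x => w x • gradient φ x) := by
  have hw : LocallyIntegrable (w : Rn n → ℝ) := (Lp.memLp w).locallyIntegrable (by norm_num)
  refine hw.integrable_smul_right_of_hasCompactSupport ?_ ?_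
  · exact (InnerProductSpace.toDual ℝ (Rn n)).symm.continuous.comp
      (hφ.continuous_fderiv (by simp))
  · exact (hc.fderiv ℝ).comp_left (g := (InnerProductSpace.toDual ℝ (Rn n)).symm) (map_zero _)

lemma integrable_smul_field {n : ℕ} (G : L2Vec n) {φ : Rn n → ℝ} (hφ : ContDiff ℝ ∞ φ)
    (hc : HasCompactSupport φ) : Integrable (fun x => φ x • G x) := by
  have hG : LocallyIntegrable (G : Rn n → Rn n) := (Lp.memLp G).locallyIntegrable (by norm_num)
  exact hG.integrable_smul_left_of_hasCompactSupport hφ.continuous hc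

/-- The Sobolev space `H¹(ℝⁿ)`: the pairs `(w, ∇w)` with `w ∈ L²` and weak gradient `∇w ∈ L²`.
It carries the topology of `L² × L²`, which is the one defined by the `H¹` norm. -/
def H1 (n : ℕ) : Submodule ℝ (L2 n × L2Vec n) where
  carrier := {w | IsWeakGradient (w.1 : Rn n → ℝ) (w.2 : Rn n → Rn n)}
  zero_mem' := by
    intro φ _ _
    have h1 : ∫ x, ((0 : L2 n × L2Vec n).1 : Rn n → ℝ) x • gradient φ x = ∫ _ : Rn n, (0 : Rn n) :=
      integral_congr_ae (by
        filter_upwards [Lp.coeFn_zero ℝ 2 (volume : Measure (Rn n))] with x hx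
        simp only [Prod.fst_zero, hx, Pi.zero_apply, zero_smul])
    have h2 : ∫ x, φ x • ((0 : L2 n × L2Vec n).2 : Rn n → Rn n) x = ∫ _ : Rn n, (0 : Rn n) :=
      integral_congr_ae (by
        filter_upwards [Lp.coeFn_zero (Rn n) 2 (volume : Measure (Rn n))] with x hx
        simp only [Prod.snd_zero, hx, Pi.zero_apply, smul_zero])
    rw [h1, h2]
    simp
  add_mem' := by
    intro a b ha hb φ hφ hc
    have h1 : ∫ x, ((a + b).1 : Rn n → ℝ) x • gradient φ x
        = ∫ x, (a.1 x • gradient φ x + b.1 x • gradient φ x) :=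
      integral_congr_ae (by
        filter_upwards [Lp.coeFn_add a.1 b.1] with x hx
        simp only [Prod.fst_add, hx, Pi.add_apply, add_smul])
    have h2 : ∫ x, φ x • ((a + b).2 : Rn n → Rn n) x
        = ∫ x, (φ x • a.2 x + φ x • b.2 x) :=
      integral_congr_ae (by
        filter_upwards [Lp.coeFn_add a.2 b.2] with x hx
        simp only [Prod.snd_add, hx, Pi.add_apply, smul_add])
    rw [h1, h2, integral_add (integrable_smul_gradient a.1 hφ hc)
      (integrable_smul_gradient b.1 hφ hc), integral_add (integrable_smul_field a.2 hφ hc)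
      (integrable_smul_field b.2 hφ hc), ha φ hφ hc, hb φ hφ hc, neg_add]
  smul_mem' := by
    intro c a ha φ hφ hc
    have h1 : ∫ x, ((c • a).1 : Rn n → ℝ) x • gradient φ x
        = ∫ x, c • (a.1 x • gradient φ x) :=
      integral_congr_ae (by
        filter_upwards [Lp.coeFn_smul c a.1] with x hx
        simp only [Prod.smul_fst, hx, Pi.smul_apply, smul_assoc])
    have h2 : ∫ x, φ x • ((c • a).2 : Rn n → Rn n) x = ∫ x, c • (φ x • a.2 x) :=
      integral_congr_ae (by
        filter_upwards [Lp.coeFn_smul c a.2] with x hx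
        simp only [Prod.smul_snd, hx, Pi.smul_apply, smul_comm c])
    rw [h1, h2, integral_smul, integral_smul, ha φ hφ hc, smul_neg]

/-- The underlying `L²` function of an element of `H¹`. -/
def H1.fn {n : ℕ} (w : H1 n) : L2 n := w.1.1

/-- The weak gradient of an element of `H¹`. -/
def H1.grad {n : ℕ} (w : H1 n) : L2Vec n := w.1.2

/-- The damping coefficient `μ / (1 + |x|)^β`. -/
noncomputable def damping {n : ℕ} (μ β : ℝ) (x : Rn n) : ℝ := μ / (1 + ‖x‖) ^ β

/-- The time derivative `u_t` on `[0, T)` of a curve in `H¹`, taken in `L²`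
(one-sided at `t = 0`). -/
noncomputable def timeDeriv {n : ℕ} (T : ℝ) (u : ℝ → H1 n) (t : ℝ) : L2 n :=
  derivWithin (fun s => H1.fn (u s)) (Set.Ico 0 T) t

/-- `u` is an energy solution on `[0, T)` of
`u_tt - Δu + μ (1 + |x|)^(-β) u_t = |u_t|^p`, `u(0) = ε f`, `u_t(0) = ε g`.
A test function is the restriction to `t ≥ 0` of a smooth function on `ℝ × ℝⁿ` with compact
support in `{t < T}`; it need not vanish at `t = 0`. -/
structure IsEnergySolution {n : ℕ} (μ β p : ℝ) (f : H1 n) (g : L2 n) (ε T : ℝ)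
    (u : ℝ → H1 n) : Prop where
  /-- `u ∈ C([0, T), H¹)` -/
  continuousOn : ContinuousOn u (Set.Ico 0 T)
  /-- `u ∈ C¹([0, T), L²)` -/
  contDiffOn : ContDiffOn ℝ 1 (fun t => H1.fn (u t)) (Set.Ico 0 T)
  /-- `|u_t|^p` is integrable on every compact subset of `[0, T) × ℝⁿ`. -/
  locLp : ∀ S < T, ∀ R : ℝ,
    ∫⁻ t in Set.Ioo 0 S, ∫⁻ x in Metric.ball (0 : Rn n) R, ‖timeDeriv T u t x‖ₑ ^ p < ⊤
  initial : u 0 = ε • f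
  initial_deriv : timeDeriv T u 0 = ε • g
  weak_form : ∀ Ψ : ℝ × Rn n → ℝ, ContDiff ℝ ∞ Ψ → HasCompactSupport Ψ →
    tsupport Ψ ⊆ Set.Iio T ×ˢ Set.univ →
    ε * (∫ x, g x * Ψ (0, x)) + ε * (∫ x, damping μ β x * H1.fn f x * Ψ (0, x))
        + ∫ t in Set.Ioo 0 T, ∫ x, |timeDeriv T u t x| ^ p * Ψ (t, x)
      = - (∫ t in Set.Ioo 0 T, ∫ x, timeDeriv T u t x * deriv (fun s => Ψ (s, x)) t)
        + (∫ t in Set.Ioo 0 T, ∫ x, inner ℝ (H1.grad (u t) x) (gradient (fun y => Ψ (t, y)) x))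
        - ∫ t in Set.Ioo 0 T, ∫ x, damping μ β x * H1.fn (u t) x * deriv (fun s => Ψ (s, x)) t

/-- `supp u ⊆ {(x, t) : 0 ≤ t < T, |x| ≤ t + 1}`. -/
def HasConeSupport {n : ℕ} (T : ℝ) (u : ℝ → H1 n) : Prop :=
  ∀ t ∈ Set.Ico 0 T, ∀ᵐ x : Rn n, t + 1 < ‖x‖ → H1.fn (u t) x = 0

/-- The Glassey exponent: `p_G(n) = (n + 1) / (n - 1)` for `n ≥ 2` and `p_G(1) = ∞`
(only used for `n ≥ 1`). -/
noncomputable def glasseyExponent (n : ℕ) : EReal :=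
  if n ≤ 1 then ⊤ else (((n + 1 : ℝ) / (n - 1 : ℝ) : ℝ) : EReal)

/-! The proof is a test function argument. Write `a` for the damping coefficient and `m = (n - 1) /
2`. If `Δφ = (1 + a) φ` with `φ > 0`, then `e^{-t} φ` solves the adjoint linear equation `ψ_tt - Δψ
- a ψ_t = 0`. Since `a` decays like `|x|^{-β}` with `β > 2`, it does not change the growth of `φ`,
which stays `O((1 + |x|)^{-m} e^{|x|})`. Hence `e^{-t} φ` has integral `O((1 + t)^m)` over the ball
`|x| ≤ t + 1`.

Testing with `-θ'(t) φ(x)`, where `θ = η e^{-t}` and `η` is a time cutoff, and integrating by parts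
puts only `u_t` in the bulk terms (`IsEnergySolution.identity`). The terms in which `η` is not
differentiated cancel, and those with `η'` or `η''` are absorbed by Young's inequality into the
nonlinear term (`spatial_estimate`). The datum `f` contributes with a good sign because `Δφ ≥ 0`.
What remains is `ε ∫ g ≤ C ∫_0^S w^q (1 + t)^m dt`, with `q = p / (p - 1)` and `w` a bound for the
derivatives of the cutoff parameter (`exists_lifespan_inequality`).

A linear cutoff, `w = 1 / S`, gives `ε ≤ C S^{m - 1/(p-1)}`, which settles the subcritical case.
When `m = 1/(p-1)` this has no decay; a logarithmic cutoff, `w = 4 / ((1 + t) L)` with `L ~ log S`,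
gives `ε ≤ C L^{-1/(p-1)}` instead.

Test functions must be smooth, while `a` need not be smooth at the origin. So `φ` is replaced on
each ball by a polynomial in `|x|²` that solves its equation up to an error `δ`, with growth
constants independent of the ball and of `δ` (`exists_radial_profile`). Taking `δ ≤ w` makes this
error one more cutoff term. -/

/-! ### The radial Laplacian on polynomials in `|x|²` and its comparison principle. -/

/-- The polynomial `4 s G'' + 2 n G'`; the Laplacian of `x ↦ G (|x|²)` on `ℝⁿ` is the value of this
polynomial at `|x|²`. -/
noncomputable def radialLap (n : ℕ) (G : Polynomial ℝ) : Polynomial ℝ :=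
  Polynomial.C 4 * Polynomial.X * G.derivative.derivative
    + Polynomial.C (2 * (n : ℝ)) * G.derivative

lemma radialLap_add (n : ℕ) (G H : Polynomial ℝ) :
    radialLap n (G + H) = radialLap n G + radialLap n H := by
  simp only [radialLap, Polynomial.derivative_add]; ring

lemma radialLap_sub (n : ℕ) (G H : Polynomial ℝ) :
    radialLap n (G - H) = radialLap n G - radialLap n H := by
  simp only [radialLap, Polynomial.derivative_sub]; ring

lemma radialLap_one (n : ℕ) : radialLap n 1 = 0 := by simp [radialLap]

lemma radialLap_monomial (n k : ℕ) (a : ℝ) :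
    radialLap n (Polynomial.monomial (k + 1) a)
      = Polynomial.monomial k (a * ((k + 1) * (4 * k + 2 * n))) := by
  rcases k with _ | k
  · simp [radialLap]
    ring
  · simp only [radialLap, Polynomial.derivative_monomial, add_tsub_cancel_right]
    rw [mul_assoc, Polynomial.X_mul_monomial, Polynomial.C_mul_monomial,
      Polynomial.C_mul_monomial, ← map_add]
    congr 1; push_cast; ring

lemma exists_radialLap_eq {n : ℕ} (hn : 1 ≤ n) (P : Polynomial ℝ) :
    ∃ Q, radialLap n Q = P ∧ Q.eval 0 = 0 := by
  induction P using Polynomial.induction_on' with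
  | add p q hp hq =>
    obtain ⟨P, hP, hP0⟩ := hp
    obtain ⟨Q, hQ, hQ0⟩ := hq
    exact ⟨P + Q, by rw [radialLap_add, hP, hQ], by simp [hP0, hQ0]⟩
  | monomial k a =>
    have h : ((k : ℝ) + 1) * (4 * k + 2 * n) ≠ 0 := by positivity
    refine ⟨Polynomial.monomial (k + 1) (a / ((k + 1) * (4 * k + 2 * n))), ?_, ?_⟩
    · rw [radialLap_monomial, div_mul_cancel₀ _ h]
    · simp [Polynomial.eval_monomial]

/-- Divergence form of the radial Laplacian: for `φ(r) = Q(r²)` in dimension `m + 1` this is `(r^m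
φ')' = r^m Δφ`. All comparison arguments rest on it. -/
lemma hasDerivAt_pow_mul_derivative_eval_sq (m : ℕ) (Q : Polynomial ℝ) (r : ℝ) :
    HasDerivAt (fun r : ℝ => 2 * r ^ (m + 1) * Q.derivative.eval (r ^ 2))
      (r ^ m * (radialLap (m + 1) Q).eval (r ^ 2)) r := by
  have h1 : HasDerivAt (fun r : ℝ => Q.derivative.eval (r ^ 2))
      (Q.derivative.derivative.eval (r ^ 2) * (2 * r)) r := by
    have := (Q.derivative.hasDerivAt (r ^ 2)).comp r (hasDerivAt_pow 2 r)
    simpa [Function.comp_def] using this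
  have h2 := ((hasDerivAt_pow (m + 1) r).const_mul 2).mul h1
  refine h2.congr_deriv ?_
  simp only [radialLap, Polynomial.eval_add, Polynomial.eval_mul, Polynomial.eval_C,
    Polynomial.eval_X, add_tsub_cancel_right]
  push_cast
  ring

/-- The flux `r^{n-1} φ'` vanishes at `0` and is nondecreasing where the Laplacian is nonnegative.
-/
lemma derivative_nonneg_of_radialLap_nonneg {n : ℕ} (hn : 1 ≤ n) {Q : Polynomial ℝ} {A : ℝ}
    (h : ∀ s ∈ Set.Icc 0 A, 0 ≤ (radialLap n Q).eval s) {s : ℝ} (hs : s ∈ Set.Ioc 0 A) :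
    0 ≤ Q.derivative.eval s := by
  obtain ⟨m, rfl⟩ : ∃ m, n = m + 1 := ⟨n - 1, by omega⟩
  have hsq : √s ^ 2 = s := Real.sq_sqrt hs.1.le
  have hmono : MonotoneOn (fun r : ℝ => 2 * r ^ (m + 1) * Q.derivative.eval (r ^ 2))
      (Set.Icc 0 √s) := by
    have hd := hasDerivAt_pow_mul_derivative_eval_sq m Q
    refine monotoneOn_of_deriv_nonneg (convex_Icc _ _)
      (fun r _ => (hd r).continuousAt.continuousWithinAt)
      (fun r _ => (hd r).differentiableAt.differentiableWithinAt) fun r hr => ?_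
    rw [interior_Icc] at hr
    rw [(hd r).deriv]
    refine mul_nonneg (pow_nonneg hr.1.le _) (h _ ⟨sq_nonneg _, ?_⟩)
    calc r ^ 2 ≤ √s ^ 2 := by have := hr.1; have := hr.2; gcongr
      _ ≤ A := hsq.trans_le hs.2
  have h0 := hmono (Set.left_mem_Icc.2 (Real.sqrt_nonneg s)) (Set.right_mem_Icc.2
    (Real.sqrt_nonneg s)) (Real.sqrt_nonneg s)
  simp only [ne_eq, Nat.add_eq_zero_iff, one_ne_zero, and_false, not_false_eq_true, zero_pow,
    mul_zero, zero_mul, hsq] at h0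
  have hpos : 0 < 2 * √s ^ (m + 1) := by have := Real.sqrt_pos.2 hs.1; positivity
  exact nonneg_of_mul_nonneg_right h0 hpos

lemma monotoneOn_of_radialLap_nonneg {n : ℕ} (hn : 1 ≤ n) {Q : Polynomial ℝ} {A : ℝ}
    (h : ∀ s ∈ Set.Icc 0 A, 0 ≤ (radialLap n Q).eval s) :
    MonotoneOn (fun s => Q.eval s) (Set.Icc 0 A) := by
  refine monotoneOn_of_deriv_nonneg (convex_Icc _ _) Q.continuous.continuousOn
    Q.differentiable.differentiableOn fun r hr => ?_
  rw [interior_Icc] at hr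
  rw [Polynomial.deriv]
  exact derivative_nonneg_of_radialLap_nonneg hn h ⟨hr.1, hr.2.le⟩

lemma eval_nonneg_of_radialLap_nonneg {n : ℕ} (hn : 1 ≤ n) {Q : Polynomial ℝ} {A : ℝ}
    (h : ∀ s ∈ Set.Icc 0 A, 0 ≤ (radialLap n Q).eval s) (h0 : 0 ≤ Q.eval 0) {s : ℝ}
    (hs : s ∈ Set.Icc 0 A) : 0 ≤ Q.eval s :=
  h0.trans (monotoneOn_of_radialLap_nonneg hn h ⟨le_rfl, hs.1.trans hs.2⟩ hs hs.1)

/-! ### Picard iteration for the radial equation. -/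

/-- Picard iterates of the equation `4 s G'' + 2 n G' = c G`, `G(0) = 1`. -/
lemma exists_picard_seq {n : ℕ} (hn : 1 ≤ n) (c : Polynomial ℝ) :
    ∃ G : ℕ → Polynomial ℝ, G 0 = 1 ∧ (∀ k, (G k).eval 0 = 1) ∧
      ∀ k, radialLap n (G (k + 1)) = c * G k := by
  choose V hV hV0 using exists_radialLap_eq hn
  refine ⟨fun k => Nat.rec 1 (fun _ P => 1 + V (c * P)) k, rfl, fun k => ?_, fun k => ?_⟩
  · rcases k with _ | k
    · simp
    · simp [hV0]
  · simp only [radialLap_add, radialLap_one, hV, zero_add]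

section Picard

variable {n : ℕ} {c : Polynomial ℝ} {A M : ℝ} {G : ℕ → Polynomial ℝ}

/-- Induction with the comparison principle: consecutive differences vanish at `0`, and their
Laplacian is `c` times the preceding difference. -/
lemma picard_mono (hn : 1 ≤ n) (hc : ∀ s ∈ Set.Icc 0 A, 1 ≤ c.eval s) (hG0 : G 0 = 1)
    (hG1 : ∀ k, (G k).eval 0 = 1) (hG : ∀ k, radialLap n (G (k + 1)) = c * G k) (k : ℕ) :
    ∀ s ∈ Set.Icc 0 A, 1 ≤ (G k).eval s ∧ (G k).eval s ≤ (G (k + 1)).eval s := by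
  induction k with
  | zero =>
    intro s hs
    refine ⟨by simp [hG0], ?_⟩
    have := eval_nonneg_of_radialLap_nonneg hn (Q := G 1 - G 0) (A := A) (fun s hs => ?_)
      (by simp [hG1]) hs
    · simpa using this
    · have := hc s hs
      rw [radialLap_sub, hG, hG0, radialLap_one]
      simp; linarith
  | succ k ih =>
    intro s hs
    refine ⟨(ih s hs).1.trans (ih s hs).2, ?_⟩
    have := eval_nonneg_of_radialLap_nonneg hn (Q := G (k + 2) - G (k + 1)) (A := A)
      (fun s hs => ?_) (by simp [hG1]) hs
    · simpa using this
    · have h1 := hc s hs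
      have h2 := (ih s hs).2
      rw [radialLap_sub, hG, hG, ← mul_sub, Polynomial.eval_mul, Polynomial.eval_sub]
      exact mul_nonneg (by linarith) (by linarith)

/-- The monomial `(M s)^{k+1} / (k+1)!` is a barrier: its radial Laplacian is `4k + 2n ≥ 1` times `M
(M s)^k / k!`, which bounds `c` times the preceding difference. -/
lemma picard_diff_le (hn : 1 ≤ n) (hc : ∀ s ∈ Set.Icc 0 A, 1 ≤ c.eval s)
    (hcM : ∀ s ∈ Set.Icc 0 A, c.eval s ≤ M) (hG0 : G 0 = 1)
    (hG1 : ∀ k, (G k).eval 0 = 1) (hG : ∀ k, radialLap n (G (k + 1)) = c * G k) (k : ℕ) :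
    ∀ s ∈ Set.Icc 0 A,
      (G (k + 1)).eval s - (G k).eval s ≤ (M * s) ^ (k + 1) / (k + 1).factorial := by
  have hn' : (1 : ℝ) ≤ n := by exact_mod_cast hn
  have hcoef : ∀ k : ℕ, M ^ (k + 1) / (k + 1).factorial * ((k + 1) * (4 * k + 2 * n))
      = M * (M ^ k / k.factorial) * (4 * k + 2 * n) := by
    intro k
    rw [Nat.factorial_succ]; push_cast; field_simp; ring
  have key : ∀ k : ℕ, (∀ s ∈ Set.Icc 0 A, (radialLap n (G (k + 1) - G k)).eval s
      ≤ M * ((M * s) ^ k / k.factorial)) → ∀ s ∈ Set.Icc 0 A,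
      (G (k + 1)).eval s - (G k).eval s ≤ (M * s) ^ (k + 1) / (k + 1).factorial := by
    intro k hk s hs
    have := eval_nonneg_of_radialLap_nonneg hn
      (Q := Polynomial.monomial (k + 1) (M ^ (k + 1) / (k + 1).factorial) - (G (k + 1) - G k))
      (A := A) (fun s hs => ?_) (by simp [hG1]) hs
    · simp only [Polynomial.eval_sub, Polynomial.eval_monomial, sub_nonneg] at this
      rwa [mul_pow, mul_div_right_comm]
    · have h1 := hk s hs
      have hM : 0 ≤ M := by linarith [hc s hs, hcM s hs]
      have h2 : 0 ≤ M * ((M * s) ^ k / k.factorial) := by have := hs.1; positivity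
      rw [radialLap_sub, radialLap_monomial, Polynomial.eval_sub, Polynomial.eval_monomial,
        hcoef, sub_nonneg]
      refine h1.trans ?_
      have h3 : M * (M ^ k / k.factorial) * (4 * k + 2 * n) * s ^ k
          = M * ((M * s) ^ k / k.factorial) * (4 * k + 2 * n) := by rw [mul_pow]; ring
      rw [h3]
      refine le_mul_of_one_le_right h2 ?_
      have : (0 : ℝ) ≤ k := by positivity
      linarith
  induction k with
  | zero =>
    refine key 0 fun s hs => ?_
    rw [radialLap_sub, hG, hG0, radialLap_one]
    simpa using hcM s hs
  | succ k ih =>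
    refine key (k + 1) fun s hs => ?_
    have h1 := hc s hs
    have h2 := (picard_mono hn hc hG0 hG1 hG k s hs).2
    rw [radialLap_sub, hG, hG, ← mul_sub, Polynomial.eval_mul, Polynomial.eval_sub]
    exact mul_le_mul (hcM s hs) (ih s hs) (by linarith) (by linarith [hcM s hs])

lemma picard_le_exp (hn : 1 ≤ n) (hc : ∀ s ∈ Set.Icc 0 A, 1 ≤ c.eval s)
    (hcM : ∀ s ∈ Set.Icc 0 A, c.eval s ≤ M) (hG0 : G 0 = 1)
    (hG1 : ∀ k, (G k).eval 0 = 1) (hG : ∀ k, radialLap n (G (k + 1)) = c * G k) (k : ℕ)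
    {s : ℝ} (hs : s ∈ Set.Icc 0 A) : (G k).eval s ≤ Real.exp (M * s) := by
  have hM : 0 ≤ M := by linarith [hc s hs, hcM s hs]
  refine le_trans ?_ (Real.sum_le_exp_of_nonneg (mul_nonneg hM hs.1) (k + 1))
  induction k with
  | zero => simp [hG0]
  | succ k ih =>
    rw [Finset.sum_range_succ]
    linarith [picard_diff_le hn hc hcM hG0 hG1 hG k s hs]

end Picard

/-! ### Sharp growth of radial subsolutions and the approximate profile. -/

/-- The quantity `2 r^n (M Q - Q')` at `r²` vanishes at `0` and is nondecreasing. Used at `s = 1`,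
it supplies the initial slope for `radial_growth`. -/
lemma derivative_le_of_radialLap_le {n : ℕ} (hn : 1 ≤ n) {Q : Polynomial ℝ} {A M : ℝ}
    (hM : 0 ≤ M) (h0 : ∀ s ∈ Set.Icc 0 A, 0 ≤ (radialLap n Q).eval s)
    (h : ∀ s ∈ Set.Icc 0 A, (radialLap n Q).eval s ≤ M * Q.eval s) (hQ0 : 0 ≤ Q.eval 0)
    {s : ℝ} (hs : s ∈ Set.Ioc 0 A) : Q.derivative.eval s ≤ M * Q.eval s := by
  obtain ⟨m, rfl⟩ : ∃ m, n = m + 1 := ⟨n - 1, by omega⟩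
  have hsq : √s ^ 2 = s := Real.sq_sqrt hs.1.le
  have hd : ∀ r : ℝ, HasDerivAt (fun r : ℝ => 2 * M * (r ^ (m + 1) * Q.eval (r ^ 2))
        - 2 * r ^ (m + 1) * Q.derivative.eval (r ^ 2))
      (2 * M * (((m + 1 : ℕ) : ℝ) * r ^ m * Q.eval (r ^ 2)
        + r ^ (m + 1) * (Q.derivative.eval (r ^ 2) * (2 * r)))
        - r ^ m * (radialLap (m + 1) Q).eval (r ^ 2)) r := by
    intro r
    have h1 : HasDerivAt (fun r : ℝ => Q.eval (r ^ 2)) (Q.derivative.eval (r ^ 2) * (2 * r)) r := by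
      have := (Q.hasDerivAt (r ^ 2)).comp r (hasDerivAt_pow 2 r)
      simpa [Function.comp_def] using this
    have h2 := ((hasDerivAt_pow (m + 1) r).mul h1).const_mul (2 * M)
    exact h2.sub (hasDerivAt_pow_mul_derivative_eval_sq m Q r)
  have hmono : MonotoneOn (fun r : ℝ => 2 * M * (r ^ (m + 1) * Q.eval (r ^ 2))
        - 2 * r ^ (m + 1) * Q.derivative.eval (r ^ 2)) (Set.Icc 0 √s) := by
    refine monotoneOn_of_deriv_nonneg (convex_Icc _ _)
      (fun r _ => (hd r).continuousAt.continuousWithinAt)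
      (fun r _ => (hd r).differentiableAt.differentiableWithinAt) fun r hr => ?_
    rw [interior_Icc] at hr
    rw [(hd r).deriv]
    have hr0 : 0 < r := hr.1
    have hrA : r ^ 2 ≤ A := calc r ^ 2 ≤ √s ^ 2 := by have := hr.2; gcongr
      _ ≤ A := hsq.trans_le hs.2
    have h1 := derivative_nonneg_of_radialLap_nonneg hn h0 (s := r ^ 2) ⟨by positivity, hrA⟩
    have h2 := h (r ^ 2) ⟨sq_nonneg r, hrA⟩
    have h3 := eval_nonneg_of_radialLap_nonneg hn h0 hQ0 (s := r ^ 2) ⟨sq_nonneg r, hrA⟩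
    have h4 : r ^ m * (radialLap (m + 1) Q).eval (r ^ 2) ≤ r ^ m * (M * Q.eval (r ^ 2)) := by
      gcongr
    have h5 : 0 ≤ 2 * M * (r ^ (m + 1) * (Q.derivative.eval (r ^ 2) * (2 * r))) := by positivity
    have h6 : 0 ≤ (m : ℝ) * (M * (r ^ m * Q.eval (r ^ 2))) := by positivity
    have h7 : 0 ≤ M * (r ^ m * Q.eval (r ^ 2)) := by positivity
    push_cast
    nlinarith
  have h0' := hmono (Set.left_mem_Icc.2 (Real.sqrt_nonneg s)) (Set.right_mem_Icc.2
    (Real.sqrt_nonneg s)) (Real.sqrt_nonneg s)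
  simp only [ne_eq, Nat.add_eq_zero_iff, one_ne_zero, and_false, not_false_eq_true, zero_pow,
    mul_zero, zero_mul, hsq, sub_zero] at h0'
  have hpos : 0 < 2 * √s ^ (m + 1) := by have := Real.sqrt_pos.2 hs.1; positivity
  have : 0 ≤ 2 * √s ^ (m + 1) * (M * Q.eval s - Q.derivative.eval s) := by linarith
  linarith [nonneg_of_mul_nonneg_right this hpos]

/-- Liouville's substitution `v = r^m φ`, `φ(r) = Q(r²)`, removes the first-order term and gives
`v'' - v ≤ (K / r² + δ) v`. Since `v ≤ v + v'`, Gronwall applies to `e^{-r} (v + v')`, which is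
`e^{-r} r^m Y`. The integrating factor `exp(K / r - δ r)` stays between positive constants on `[1,
R]`, because `1 / r²` is integrable at infinity and `δ R ≤ 1`. -/
lemma radial_growth {n : ℕ} {Q : Polynomial ℝ} {R μ δ M m : ℝ} (hm : m = ((n : ℝ) - 1) / 2)
    (hm0 : 0 ≤ m) (hR : 1 ≤ R) (hμ : 0 ≤ μ) (hδ : 0 ≤ δ) (hδR : δ * R ≤ 1)
    (hQ : ∀ s ∈ Set.Icc 0 (R ^ 2), 0 ≤ Q.eval s)
    (hQ' : ∀ s ∈ Set.Ioc 0 (R ^ 2), 0 ≤ Q.derivative.eval s)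
    (h : ∀ r ∈ Set.Icc 1 R, (radialLap n Q).eval (r ^ 2) ≤ (1 + μ / r ^ 2 + δ) * Q.eval (r ^ 2))
    (h1 : Q.eval 1 ≤ Real.exp M) (h1' : Q.derivative.eval 1 ≤ M * Real.exp M)
    {r : ℝ} (hr : r ∈ Set.Icc 1 R) :
    Q.eval (r ^ 2) ≤ r ^ (-m) * Real.exp r *
      (Real.exp (μ + m ^ 2 + 1) * ((2 * M + 1 + m) * Real.exp M)) := by
  set K := μ + m ^ 2 with hK
  have hK0 : 0 ≤ K := by positivity
  set Y : ℝ → ℝ := fun r => 2 * r * Q.derivative.eval (r ^ 2) + (1 + m / r) * Q.eval (r ^ 2)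
    with hY
  set Z : ℝ → ℝ := fun r => Real.exp (K / r - δ * r - r) * r ^ m * Y r with hZ
  have hQY : ∀ r ∈ Set.Icc 1 R, Q.eval (r ^ 2) ≤ Y r := by
    intro r hr
    have hr0 : 0 < r := by linarith [hr.1]
    have hr2 : r ^ 2 ≤ R ^ 2 := by have := hr.2; gcongr
    have a1 := hQ _ ⟨sq_nonneg r, hr2⟩
    have a2 := hQ' (r ^ 2) ⟨by positivity, hr2⟩
    have a3 : 0 ≤ 2 * r * Q.derivative.eval (r ^ 2) := by positivity
    have a4 : 0 ≤ m / r * Q.eval (r ^ 2) := by positivity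
    simp only [hY]; linarith
  have hd : ∀ r : ℝ, 0 < r → HasDerivAt Z (Real.exp (K / r - δ * r - r) * r ^ m *
      ((radialLap n Q).eval (r ^ 2) + ((m ^ 2 - m) / r ^ 2 - 1) * Q.eval (r ^ 2)
        - (K / r ^ 2 + δ) * Y r)) r := by
    intro r hr
    have e1 : HasDerivAt (fun r : ℝ => Q.eval (r ^ 2)) (Q.derivative.eval (r ^ 2) * (2 * r)) r := by
      have := (Q.hasDerivAt (r ^ 2)).comp r (hasDerivAt_pow 2 r)
      simpa [Function.comp_def] using this
    have e2 : HasDerivAt (fun r : ℝ => Q.derivative.eval (r ^ 2))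
        (Q.derivative.derivative.eval (r ^ 2) * (2 * r)) r := by
      have := (Q.derivative.hasDerivAt (r ^ 2)).comp r (hasDerivAt_pow 2 r)
      simpa [Function.comp_def] using this
    have e3 : HasDerivAt (fun r : ℝ => 1 + m / r) (m * (-(r ^ 2)⁻¹)) r := by
      simpa [div_eq_mul_inv] using ((hasDerivAt_inv hr.ne').const_mul m).const_add 1
    have e4 : HasDerivAt (fun r : ℝ => K / r - δ * r - r) (K * (-(r ^ 2)⁻¹) - δ - 1) r := by
      have := (((hasDerivAt_inv hr.ne').const_mul K).fun_sub ((hasDerivAt_id' r).const_mul δ)).fun_sub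
        (hasDerivAt_id' r)
      simpa [div_eq_mul_inv] using this
    have e5 : HasDerivAt (fun r : ℝ => r ^ m) (m * r ^ m / r) r := by
      have := Real.hasDerivAt_rpow_const (p := m) (Or.inl hr.ne')
      rwa [Real.rpow_sub_one hr.ne', mul_div_assoc'] at this
    have e6 : HasDerivAt (fun r : ℝ => 2 * r) 2 r := by
      simpa using (hasDerivAt_id r).const_mul 2
    have := (e4.exp.mul e5).mul ((e6.mul e2).add (e3.mul e1))
    refine this.congr_deriv ?_
    have hn : (n : ℝ) = 2 * m + 1 := by rw [hm]; ring
    simp only [radialLap, Polynomial.eval_add, Polynomial.eval_mul, Polynomial.eval_C,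
      Polynomial.eval_X, hY, hn, Pi.add_apply, Pi.mul_apply]
    field_simp
    ring
  have hanti : AntitoneOn Z (Set.Icc 1 R) := by
    refine antitoneOn_of_deriv_nonpos (convex_Icc _ _)
      (fun r hr => (hd r (by linarith [hr.1])).continuousAt.continuousWithinAt)
      (fun r hr => ?_) fun r hr => ?_
    · rw [interior_Icc] at hr
      exact (hd r (by linarith [hr.1])).differentiableAt.differentiableWithinAt
    · rw [interior_Icc] at hr
      have hr0 : 0 < r := by linarith [hr.1]
      have hr' : r ∈ Set.Icc 1 R := ⟨hr.1.le, hr.2.le⟩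
      rw [(hd r hr0).deriv]
      refine mul_nonpos_of_nonneg_of_nonpos (by positivity) ?_
      have a1 := h r hr'
      have a2 := hQY r hr'
      have a3 : (K / r ^ 2 + δ) * Q.eval (r ^ 2) ≤ (K / r ^ 2 + δ) * Y r := by gcongr
      have a4 : 0 ≤ m / r ^ 2 * Q.eval (r ^ 2) :=
        mul_nonneg (by positivity) (hQ _ ⟨sq_nonneg r, by have := hr.2; gcongr⟩)
      have a5 : (1 + μ / r ^ 2 + δ) * Q.eval (r ^ 2)
          + ((m ^ 2 - m) / r ^ 2 - 1) * Q.eval (r ^ 2) - (K / r ^ 2 + δ) * Q.eval (r ^ 2)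
          = - (m / r ^ 2 * Q.eval (r ^ 2)) := by
        rw [hK]; ring
      linarith
  have hr0 : 0 < r := by linarith [hr.1]
  have hZ1 : Z r ≤ Z 1 := hanti ⟨le_rfl, hR⟩ hr hr.1
  have hZ1' : Z 1 ≤ Real.exp K * ((2 * M + 1 + m) * Real.exp M) := by
    simp only [hZ, hY, Real.one_rpow, mul_one, div_one, one_pow]
    have b1 : Real.exp (K - δ - 1) ≤ Real.exp K := Real.exp_le_exp.2 (by linarith)
    have b2 : 2 * Q.derivative.eval 1 + (1 + m) * Q.eval 1 ≤ (2 * M + 1 + m) * Real.exp M := by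
      nlinarith
    have c1 := hQ' 1 ⟨one_pos, by nlinarith⟩
    have c2 := hQ 1 ⟨zero_le_one, by nlinarith⟩
    exact mul_le_mul b1 b2 (by positivity) (Real.exp_pos _).le
  have hYZ : Y r = r ^ (-m) * Real.exp (r + δ * r - K / r) * Z r := by
    have b1 : r ^ (-m) * r ^ m = 1 := by rw [← Real.rpow_add hr0]; simp
    have b2 : Real.exp (r + δ * r - K / r) * Real.exp (K / r - δ * r - r) = 1 := by
      rw [← Real.exp_add, Real.exp_eq_one_iff]; ring
    calc Y r = (r ^ (-m) * r ^ m) * (Real.exp (r + δ * r - K / r) * Real.exp (K / r - δ * r - r))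
          * Y r := by rw [b1, b2]; ring
      _ = _ := by simp only [hZ]; ring
  have hexp : Real.exp (r + δ * r - K / r) ≤ Real.exp r * Real.exp 1 := by
    rw [← Real.exp_add]
    refine Real.exp_le_exp.2 ?_
    have b1 : δ * r ≤ 1 := le_trans (by have := hr.2; gcongr) hδR
    have b2 : 0 ≤ K / r := by positivity
    linarith
  have hM' : 0 ≤ (2 * M + 1 + m) * Real.exp M := by
    have c1 := hQ' 1 ⟨one_pos, by nlinarith⟩
    have c3 : 0 ≤ M := nonneg_of_mul_nonneg_left (c1.trans h1') (Real.exp_pos _)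
    positivity
  have hZr : Z r ≤ Real.exp K * ((2 * M + 1 + m) * Real.exp M) := hZ1.trans hZ1'
  calc Q.eval (r ^ 2) ≤ Y r := hQY r hr
    _ = r ^ (-m) * Real.exp (r + δ * r - K / r) * Z r := hYZ
    _ ≤ r ^ (-m) * Real.exp (r + δ * r - K / r)
        * (Real.exp K * ((2 * M + 1 + m) * Real.exp M)) := by gcongr
    _ ≤ r ^ (-m) * (Real.exp r * Real.exp 1) *
        (Real.exp K * ((2 * M + 1 + m) * Real.exp M)) := by gcongr
    _ = _ := by rw [Real.exp_add K 1]; ring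

/-- Approximate positive radial solutions of `Δφ = (1 + μ (1 + |x|)^(-β)) φ` on balls, with the
sharp upper bound uniform in the radius of the ball. -/
lemma exists_radial_profile {n : ℕ} (hn : 1 ≤ n) {μ β : ℝ} (hμ : 0 < μ) (hβ : 2 < β) :
    ∃ C > (0 : ℝ), ∀ R ≥ (1 : ℝ), ∀ δ > (0 : ℝ), ∃ G : Polynomial ℝ, ∀ r ∈ Set.Icc 0 R,
      1 ≤ G.eval (r ^ 2) ∧
      G.eval (r ^ 2) ≤ C * ((1 + r) ^ (-(((n : ℝ) - 1) / 2)) * Real.exp r) ∧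
      1 ≤ (radialLap n G).eval (r ^ 2) ∧
      |(radialLap n G).eval (r ^ 2) - (1 + μ / (1 + r) ^ β) * G.eval (r ^ 2)| ≤ δ := by
  set m : ℝ := ((n : ℝ) - 1) / 2 with hm
  have hm0 : 0 ≤ m := by
    have : (1 : ℝ) ≤ n := by exact_mod_cast hn
    rw [hm]; linarith
  set M : ℝ := 2 + μ with hM
  have hM0 : 0 < M := by linarith
  set C₁ : ℝ := Real.exp (μ + m ^ 2 + 1) * ((2 * M + 1 + m) * Real.exp M) with hC₁
  have hC₁0 : 0 < C₁ := by positivity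
  have hC₁M : Real.exp M ≤ C₁ := by
    rw [hC₁, ← mul_assoc]
    refine le_mul_of_one_le_left (Real.exp_pos _).le (one_le_mul_of_one_le_of_one_le ?_ ?_)
    · exact Real.one_le_exp (by positivity)
    · linarith
  set C : ℝ := 2 ^ m * C₁ with hC
  have hC0 : 0 < C := by positivity
  refine ⟨C, hC0, fun R hR δ hδ => ?_⟩
  set B : ℝ := C * Real.exp R with hB
  have hB0 : 0 < B := by positivity
  -- `δ / B` keeps the coefficient error times `sup G ≤ B` below `δ`; `1 / R` is what
  -- `radial_growth` needs.
  set δ₁ : ℝ := min (δ / B) (1 / R) with hδ₁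
  have hδ₁0 : 0 < δ₁ := lt_min (by positivity) (by positivity)
  have hδ₁B : δ₁ * B ≤ δ := by
    have := min_le_left (δ / B) (1 / R)
    rwa [le_div_iff₀ hB0] at this
  have hδ₁R : δ₁ * R ≤ 1 := by
    have := min_le_right (δ / B) (1 / R)
    rwa [le_div_iff₀ (by linarith)] at this
  have hδ₁1 : δ₁ ≤ 1 := by nlinarith
  set b : ℝ → ℝ := fun r => μ / (1 + r) ^ β with hb
  have hb0 : ∀ r, 0 ≤ r → 0 ≤ b r := fun r hr => by simp only [hb]; positivity
  have hbμ : ∀ r, 0 ≤ r → b r ≤ μ := fun r hr =>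
    div_le_self hμ.le (Real.one_le_rpow (by linarith) (by linarith))
  have hbr : ∀ r, 1 ≤ r → b r ≤ μ / r ^ 2 := fun r hr => by
    simp only [hb]
    have h1 : r ^ 2 ≤ (1 + r) ^ β := by
      calc r ^ 2 ≤ (1 + r) ^ 2 := by gcongr; linarith
        _ = (1 + r) ^ (2 : ℝ) := by norm_cast
        _ ≤ (1 + r) ^ β := Real.rpow_le_rpow_of_exponent_le (by linarith) hβ.le
    gcongr
  -- Weierstrass approximation of the coefficient, shifted by `δ₁ / 2` so that `c` lies above `1 +
  -- b` and the error is one-sided.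
  obtain ⟨c, hc⟩ := exists_polynomial_near_of_continuousOn 0 (R ^ 2)
    (fun s => 1 + b √s + δ₁ / 2) (by
      have : ContinuousOn (fun s : ℝ => (1 + √s) ^ β) (Set.Icc 0 (R ^ 2)) :=
        ContinuousOn.rpow_const (by fun_prop) fun s _ =>
          Or.inl (by have := Real.sqrt_nonneg s; positivity)
      simp only [hb]
      refine ((continuousOn_const.add (continuousOn_const.div this fun s _ => ?_)).add
        continuousOn_const)
      have := Real.sqrt_nonneg s; positivity) (δ₁ / 2) (by positivity)
  have hc1 : ∀ s ∈ Set.Icc 0 (R ^ 2), 1 + b √s ≤ c.eval s := fun s hs => by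
    linarith [(abs_lt.1 (hc s hs)).1]
  have hc2 : ∀ s ∈ Set.Icc 0 (R ^ 2), c.eval s ≤ 1 + b √s + δ₁ := fun s hs => by
    linarith [(abs_lt.1 (hc s hs)).2]
  have hc3 : ∀ s ∈ Set.Icc 0 (R ^ 2), 1 ≤ c.eval s := fun s hs => by
    linarith [hc1 s hs, hb0 _ (Real.sqrt_nonneg s)]
  have hc4 : ∀ s ∈ Set.Icc 0 (R ^ 2), c.eval s ≤ M := fun s hs => by
    linarith [hc2 s hs, hbμ _ (Real.sqrt_nonneg s)]
  obtain ⟨G, hG0, hG1, hG⟩ := exists_picard_seq hn c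
  obtain ⟨k, hk⟩ : ∃ k : ℕ, (M * R ^ 2) ^ (k + 1) / (k + 1).factorial ≤ δ / M := by
    have h1 := (Filter.tendsto_add_atTop_iff_nat 1).2
      (FloorSemiring.tendsto_pow_div_factorial_atTop (M * R ^ 2))
    exact ((h1.eventually (gt_mem_nhds (show 0 < δ / M by positivity))).exists).imp
      fun k hk => hk.le
  have hmono := fun k => picard_mono hn hc3 hG0 hG1 hG k
  have hGe : ∀ s ∈ Set.Icc 0 (R ^ 2), (G (k + 1)).eval s ≤ Real.exp (M * s) := fun s hs =>
    picard_le_exp hn hc3 hc4 hG0 hG1 hG (k + 1) hs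
  have hLnn : ∀ s ∈ Set.Icc 0 (R ^ 2), 1 ≤ (radialLap n (G (k + 1))).eval s := fun s hs => by
    rw [hG, Polynomial.eval_mul]
    exact one_le_mul_of_one_le_of_one_le (hc3 s hs) (hmono k s hs).1
  have hLle : ∀ s ∈ Set.Icc 0 (R ^ 2),
      (radialLap n (G (k + 1))).eval s ≤ c.eval s * (G (k + 1)).eval s := fun s hs => by
    rw [hG, Polynomial.eval_mul]
    exact mul_le_mul_of_nonneg_left (hmono k s hs).2 (by linarith [hc3 s hs])
  have hGpos : ∀ s ∈ Set.Icc 0 (R ^ 2), 1 ≤ (G (k + 1)).eval s := fun s hs =>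
    (hmono (k + 1) s hs).1
  have hR2 : (1 : ℝ) ≤ R ^ 2 := by nlinarith
  have h1mem : (1 : ℝ) ∈ Set.Icc 0 (R ^ 2) := ⟨zero_le_one, hR2⟩
  have hmem : ∀ r ∈ Set.Icc 0 R, r ^ 2 ∈ Set.Icc 0 (R ^ 2) := fun r hr =>
    ⟨sq_nonneg r, by have := hr.1; have := hr.2; gcongr⟩
  have hupper : ∀ r ∈ Set.Icc 0 R,
      (G (k + 1)).eval (r ^ 2) ≤ C * ((1 + r) ^ (-m) * Real.exp r) := by
    intro r hr
    -- Near the origin the crude Picard bound suffices; the growth estimate starts at `r = 1`.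
    rcases le_total r 1 with hr1 | hr1
    · have d1 : (G (k + 1)).eval (r ^ 2) ≤ Real.exp M := by
        refine (hGe _ (hmem r hr)).trans (Real.exp_le_exp.2 ?_)
        have : r ^ 2 ≤ 1 := by nlinarith [hr.1]
        nlinarith
      have d2 : (2 : ℝ) ^ (-m) ≤ (1 + r) ^ (-m) :=
        Real.rpow_le_rpow_of_nonpos (by linarith [hr.1]) (by linarith) (by linarith)
      have d3 : 1 ≤ Real.exp r := Real.one_le_exp hr.1
      have d4 : (2 : ℝ) ^ m * 2 ^ (-m) = 1 := by
        rw [← Real.rpow_add two_pos]; simp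
      calc (G (k + 1)).eval (r ^ 2) ≤ C₁ := d1.trans hC₁M
        _ = C * (2 ^ (-m) * 1) := by rw [hC]; linear_combination (-C₁) * d4
        _ ≤ C * ((1 + r) ^ (-m) * Real.exp r) := by
          have := hr.1; gcongr
    · have d1 := radial_growth (n := n) (Q := G (k + 1)) (M := M) hm hm0 hR hμ.le hδ₁0.le hδ₁R
        (fun s hs => by linarith [hGpos s hs])
        (fun s hs => derivative_nonneg_of_radialLap_nonneg hn
          (fun s hs => by linarith [hLnn s hs]) hs)
        (fun r hr => by
          have hr' : r ∈ Set.Icc 0 R := ⟨by linarith [hr.1], hr.2⟩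
          refine (hLle _ (hmem r hr')).trans (mul_le_mul_of_nonneg_right ?_
            (by linarith [hGpos _ (hmem r hr')]))
          have := hc2 _ (hmem r hr')
          rw [Real.sqrt_sq hr'.1] at this
          linarith [hbr r hr.1])
        (by simpa using hGe 1 h1mem)
        ((derivative_le_of_radialLap_le hn hM0.le (fun s hs => by linarith [hLnn s hs])
          (fun s hs => (hLle s hs).trans (mul_le_mul_of_nonneg_right (hc4 s hs)
            (by linarith [hGpos s hs]))) (by simp [hG1]) (s := 1) ⟨one_pos, hR2⟩).trans
          (mul_le_mul_of_nonneg_left (by simpa using hGe 1 h1mem) hM0.le))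
        ⟨hr1, hr.2⟩
      have hr0 : 0 < r := by linarith
      have d2 : r ^ (-m) ≤ 2 ^ m * (1 + r) ^ (-m) := by
        have e1 : (2 * r) ^ (-m) ≤ (1 + r) ^ (-m) :=
          Real.rpow_le_rpow_of_nonpos (by linarith) (by linarith) (by linarith)
        rw [Real.mul_rpow two_pos.le hr0.le] at e1
        have d4 : (2 : ℝ) ^ m * 2 ^ (-m) = 1 := by
          rw [← Real.rpow_add two_pos]; simp
        calc r ^ (-m) = 2 ^ m * (2 ^ (-m) * r ^ (-m)) := by
              rw [← mul_assoc, d4, one_mul]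
          _ ≤ _ := by gcongr
      calc (G (k + 1)).eval (r ^ 2) ≤ r ^ (-m) * Real.exp r * C₁ := d1
        _ ≤ 2 ^ m * (1 + r) ^ (-m) * Real.exp r * C₁ := by gcongr
        _ = _ := by rw [hC]; ring
  refine ⟨G (k + 1), fun r hr => ⟨hGpos _ (hmem r hr), hupper r hr, hLnn _ (hmem r hr), ?_⟩⟩
  have hs := hmem r hr
  have hGB : (G (k + 1)).eval (r ^ 2) ≤ B := by
    refine (hupper r hr).trans ?_
    rw [hB]
    have e1 : (1 + r) ^ (-m) ≤ 1 :=
      Real.rpow_le_one_of_one_le_of_nonpos (by linarith [hr.1]) (by linarith)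
    have e2 : Real.exp r ≤ Real.exp R := Real.exp_le_exp.2 hr.2
    gcongr
    calc (1 + r) ^ (-m) * Real.exp r ≤ 1 * Real.exp R := by gcongr
      _ = _ := one_mul _
  have hD : (G (k + 1)).eval (r ^ 2) - (G k).eval (r ^ 2) ≤ δ / M := by
    refine (picard_diff_le hn hc3 hc4 hG0 hG1 hG k _ hs).trans (le_trans ?_ hk)
    have := hs.2
    have := hs.1
    gcongr
  have hcs1 := hc1 _ hs
  have hcs2 := hc2 _ hs
  rw [Real.sqrt_sq hr.1] at hcs1 hcs2
  have hg1 := hGpos _ hs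
  have hLle' := hLle _ hs
  have hcM := hc4 _ hs
  have hcp := hc3 _ hs
  change |_ - (1 + b r) * _| ≤ δ
  rw [abs_le]
  constructor
  · rw [hG, Polynomial.eval_mul]
    have e1 : c.eval (r ^ 2) * ((G (k + 1)).eval (r ^ 2) - (G k).eval (r ^ 2)) ≤ M * (δ / M) :=
      mul_le_mul hcM hD (by linarith [(hmono k _ hs).2]) hM0.le
    rw [mul_div_cancel₀ _ hM0.ne'] at e1
    have e2 : (1 + b r) * (G (k + 1)).eval (r ^ 2) ≤ c.eval (r ^ 2) * (G (k + 1)).eval (r ^ 2) := by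
      gcongr
    linarith
  · have e1 : c.eval (r ^ 2) * (G (k + 1)).eval (r ^ 2)
        ≤ (1 + b r + δ₁) * (G (k + 1)).eval (r ^ 2) := by gcongr
    have e2 : δ₁ * (G (k + 1)).eval (r ^ 2) ≤ δ₁ * B := by gcongr
    linarith

/-! ### The Laplacian of test functions and integration by parts in space. -/

/-- The directional derivative of `Φ` along the `i`-th coordinate vector. -/
noncomputable def coordDeriv {n : ℕ} (i : Fin n) (Φ : Rn n → ℝ) (x : Rn n) : ℝ :=
  fderiv ℝ Φ x (EuclideanSpace.single i 1)

/-- The Laplacian as the sum of the second coordinate derivatives. -/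
noncomputable def lap {n : ℕ} (Φ : Rn n → ℝ) (x : Rn n) : ℝ :=
  ∑ i, coordDeriv i (coordDeriv i Φ) x

section TestFunctions

variable {n : ℕ} {Φ : Rn n → ℝ}

lemma contDiff_coordDeriv (hΦ : ContDiff ℝ ∞ Φ) (i : Fin n) : ContDiff ℝ ∞ (coordDeriv i Φ) :=
  (hΦ.fderiv_right (m := ∞) (by simp)).clm_apply contDiff_const

lemma hasCompactSupport_coordDeriv (hc : HasCompactSupport Φ) (i : Fin n) :
    HasCompactSupport (coordDeriv i Φ) :=
  (hc.fderiv ℝ).comp_left (g := fun L : Rn n →L[ℝ] ℝ => L (EuclideanSpace.single i 1)) (by simp)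

lemma continuous_lap (hΦ : ContDiff ℝ ∞ Φ) : Continuous (lap Φ) :=
  continuous_finsetSum _ fun i _ =>
    (contDiff_coordDeriv (contDiff_coordDeriv hΦ i) i).continuous

lemma hasCompactSupport_lap (hc : HasCompactSupport Φ) : HasCompactSupport (lap Φ) := by
  refine HasCompactSupport.intro hc fun x hx => Finset.sum_eq_zero fun i _ => ?_
  have h1 : tsupport (coordDeriv i (coordDeriv i Φ)) ⊆ tsupport Φ :=
    (tsupport_fderiv_apply_subset ℝ _).trans (tsupport_fderiv_apply_subset ℝ _)
  exact image_eq_zero_of_notMem_tsupport fun h => hx (h1 h)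

lemma inner_gradient_eq_sum (Φ : Rn n → ℝ) (v x : Rn n) :
    inner ℝ v (gradient Φ x) = ∑ i, coordDeriv i Φ x * v i := by
  have h1 : inner ℝ v (gradient Φ x) = fderiv ℝ Φ x v := by
    rw [real_inner_comm, gradient, InnerProductSpace.toDual_symm_apply]
  have h2 : v = ∑ i, v i • EuclideanSpace.single i (1 : ℝ) := by
    conv_lhs => rw [← (EuclideanSpace.basisFun (Fin n) ℝ).sum_repr v]
    simp
  rw [h1]
  conv_lhs => rw [h2]
  simp [map_sum, coordDeriv, mul_comm]

lemma inner_single_gradient (φ : Rn n → ℝ) (i : Fin n) (x : Rn n) :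
    inner ℝ (EuclideanSpace.single i (1 : ℝ)) (gradient φ x) = coordDeriv i φ x := by
  rw [real_inner_comm, gradient, InnerProductSpace.toDual_symm_apply, coordDeriv]

/-- Each coordinate is the weak gradient identity tested with the corresponding partial derivative
of `Φ`. -/
lemma integral_inner_grad_gradient (w : H1 n) (hΦ : ContDiff ℝ ∞ Φ) (hc : HasCompactSupport Φ) :
    ∫ x, inner ℝ (H1.grad w x) (gradient Φ x) = -∫ x, H1.fn w x * lap Φ x := by
  have hi : ∀ i, ∫ x, coordDeriv i Φ x * (H1.grad w x) i
      = -∫ x, H1.fn w x * coordDeriv i (coordDeriv i Φ) x := by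
    intro i
    have hs := contDiff_coordDeriv hΦ i
    have hk := hasCompactSupport_coordDeriv hc i
    have h := congrArg (fun v => inner ℝ (EuclideanSpace.single i (1 : ℝ)) v) (w.2 _ hs hk)
    simp only [inner_neg_right] at h
    rw [← integral_inner (integrable_smul_gradient _ hs hk),
      ← integral_inner (integrable_smul_field _ hs hk)] at h
    simp only [inner_smul_right, inner_single_gradient] at h
    have h2 : ∀ v : Rn n, inner ℝ (EuclideanSpace.single i (1 : ℝ)) v = v i := fun v => by
      simp [EuclideanSpace.inner_single_left]
    simp only [h2] at h
    change ∫ x, coordDeriv i Φ x * (w.1.2 x) i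
      = -∫ x, w.1.1 x * coordDeriv i (coordDeriv i Φ) x
    rw [h, neg_neg]
  have int1 : ∀ i, Integrable fun x => coordDeriv i Φ x * (H1.grad w x) i := by
    intro i
    have h := (integrable_smul_field (H1.grad w) (contDiff_coordDeriv hΦ i)
      (hasCompactSupport_coordDeriv hc i)).const_inner (𝕜 := ℝ) (EuclideanSpace.single i (1 : ℝ))
    simpa [EuclideanSpace.inner_single_left, inner_smul_right] using h
  have int2 : ∀ i, Integrable fun x => H1.fn w x * coordDeriv i (coordDeriv i Φ) x := by
    intro i
    have hw : LocallyIntegrable (H1.fn w : Rn n → ℝ) :=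
      (Lp.memLp (H1.fn w)).locallyIntegrable (by norm_num)
    have hs := contDiff_coordDeriv (contDiff_coordDeriv hΦ i) i
    have hk := hasCompactSupport_coordDeriv (hasCompactSupport_coordDeriv hc i) i
    exact hw.integrable_smul_right_of_hasCompactSupport hs.continuous hk
  simp only [inner_gradient_eq_sum Φ, lap, Finset.mul_sum]
  rw [integral_finsetSum _ fun i _ => int1 i, integral_finsetSum _ fun i _ => int2 i,
    ← Finset.sum_neg_distrib]
  exact Finset.sum_congr rfl fun i _ => hi i

end TestFunctions

/-! ### Pairings with `L²` functions and the tested identity. -/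

/-- Spatial pairings as bounded functionals carry the `C¹` regularity of the `L²`-valued curve over
to scalar functions of `t`. -/
lemma exists_clm_eq_integral_mul {n : ℕ} {ρ : Rn n → ℝ} (hρ : MemLp ρ 2 volume) :
    ∃ ℓ : L2 n →L[ℝ] ℝ, ∀ w : L2 n, ℓ w = ∫ x, w x * ρ x := by
  refine ⟨innerSL ℝ (hρ.toLp ρ), fun w => ?_⟩
  rw [innerSL_apply_apply, L2.inner_def]
  refine integral_congr_ae ?_
  filter_upwards [hρ.coeFn_toLp] with x hx
  simp [hx]

section Time

variable {n : ℕ} {μ β p ε T : ℝ} {f : H1 n} {g : L2 n} {u : ℝ → H1 n}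

lemma IsEnergySolution.continuousOn_timeDeriv (hu : IsEnergySolution μ β p f g ε T u) :
    ContinuousOn (timeDeriv T u) (Set.Ico 0 T) :=
  hu.contDiffOn.continuousOn_derivWithin (uniqueDiffOn_Ico 0 T) le_rfl

lemma IsEnergySolution.hasDerivWithinAt (hu : IsEnergySolution μ β p f g ε T u)
    (ℓ : L2 n →L[ℝ] ℝ) {t : ℝ} (ht : t ∈ Set.Ico 0 T) :
    HasDerivWithinAt (fun t => ℓ (H1.fn (u t))) (ℓ (timeDeriv T u t)) (Set.Ico 0 T) t :=
  ℓ.hasFDerivAt.comp_hasDerivWithinAt t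
    ((hu.contDiffOn.differentiableOn (by simp)) t ht).hasDerivWithinAt

lemma IsEnergySolution.continuousOn_clm_timeDeriv (hu : IsEnergySolution μ β p f g ε T u)
    (ℓ : L2 n →L[ℝ] ℝ) {S : ℝ} (hST : S < T) :
    ContinuousOn (fun t => ℓ (timeDeriv T u t)) (Set.Icc 0 S) :=
  ℓ.continuous.comp_continuousOn
    (hu.continuousOn_timeDeriv.mono fun _ ht => ⟨ht.1, ht.2.trans_lt hST⟩)

lemma IsEnergySolution.continuousOn_clm (hu : IsEnergySolution μ β p f g ε T u)
    (ℓ : L2 n →L[ℝ] ℝ) {S : ℝ} (hST : S < T) :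
    ContinuousOn (fun t => ℓ (H1.fn (u t))) (Set.Icc 0 S) :=
  fun _ ht => ((hu.hasDerivWithinAt ℓ ⟨ht.1, ht.2.trans_lt hST⟩).continuousWithinAt).mono
    fun _ hs => ⟨hs.1, hs.2.trans_lt hST⟩

lemma IsEnergySolution.integral_deriv_mul (hu : IsEnergySolution μ β p f g ε T u)
    (ℓ : L2 n →L[ℝ] ℝ) {S : ℝ} (hS : 0 < S) (hST : S < T) {θ : ℝ → ℝ} (hθ : ContDiff ℝ ∞ θ)
    (hθS : θ S = 0) :
    ∫ t in 0..S, deriv θ t * ℓ (H1.fn (u t))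
      = -(θ 0 * (ε * ℓ (H1.fn f))) - ∫ t in 0..S, θ t * ℓ (timeDeriv T u t) := by
  have hcd : Continuous (deriv θ) := hθ.continuous_deriv (by simp)
  have h0 : ℓ (H1.fn (u 0)) = ε * ℓ (H1.fn f) := by
    rw [hu.initial]
    change ℓ (ε • H1.fn f) = _
    rw [map_smul, smul_eq_mul]
  have key := intervalIntegral.integral_mul_deriv_eq_deriv_mul_of_hasDeriv_right
    (a := 0) (b := S) (u := θ) (u' := deriv θ) (v := fun t => ℓ (H1.fn (u t)))
    (v' := fun t => ℓ (timeDeriv T u t)) hθ.continuous.continuousOn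
    (by rw [Set.uIcc_of_le hS.le]; exact hu.continuousOn_clm ℓ hST)
    (fun t _ => ((hθ.differentiable (by simp)) t).hasDerivAt.hasDerivWithinAt)
    (fun t ht => by
      rw [min_eq_left hS.le, max_eq_right hS.le] at ht
      have hm : Set.Ico 0 T ∈ nhds t := Ico_mem_nhds ht.1 (ht.2.trans hST)
      exact ((hu.hasDerivWithinAt ℓ ⟨ht.1.le, ht.2.trans hST⟩).hasDerivAt hm).hasDerivWithinAt)
    (hcd.intervalIntegrable _ _)
    (ContinuousOn.intervalIntegrable (by
      rw [Set.uIcc_of_le hS.le]; exact hu.continuousOn_clm_timeDeriv ℓ hST))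
  rw [hθS, zero_mul, h0] at key
  linarith

lemma setIntegral_Ioo_eq_intervalIntegral {F : ℝ → ℝ} {S : ℝ} (hS : 0 ≤ S) (hST : S < T)
    (hF : ∀ t, S ≤ t → F t = 0) : ∫ t in Set.Ioo 0 T, F t = ∫ t in 0..S, F t := by
  rw [intervalIntegral.integral_of_le hS, ← integral_Ioc_eq_integral_Ioo]
  refine setIntegral_eq_of_subset_of_forall_sdiff_eq_zero measurableSet_Ioc
    (Set.Ioc_subset_Ioc_right hST.le) fun t ht => hF t ?_
  by_contra h
  exact ht.2 ⟨ht.1.1, (not_le.1 h).le⟩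

lemma continuous_damping (μ β : ℝ) : Continuous (damping (n := n) μ β) := by
  have h : ∀ x : Rn n, 0 < 1 + ‖x‖ := fun x => by positivity
  refine continuous_const.div ?_ fun x => (Real.rpow_pos_of_pos (h x) β).ne'
  exact Continuous.rpow_const (by fun_prop) fun x => Or.inl (h x).ne'

/-- The weak formulation tested with `-θ'(t) Φ(x)` and integrated by parts in time and space:
the terms containing `a f` cancel. -/
lemma IsEnergySolution.identity (hu : IsEnergySolution μ β p f g ε T u) {S : ℝ} (hS : 0 < S)
    (hST : S < T) {θ : ℝ → ℝ} (hθ : ContDiff ℝ ∞ θ) (hθS : ∀ t, S ≤ t → θ t = 0)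
    {Φ : Rn n → ℝ} (hΦ : ContDiff ℝ ∞ Φ) (hc : HasCompactSupport Φ) :
    -deriv θ 0 * (ε * ∫ x, g x * Φ x) + θ 0 * (ε * ∫ x, H1.fn f x * lap Φ x)
        - ∫ t in 0..S, deriv θ t * ∫ x, |timeDeriv T u t x| ^ p * Φ x
      = ∫ t in 0..S, (deriv (deriv θ) t * (∫ x, timeDeriv T u t x * Φ x)
        - θ t * (∫ x, timeDeriv T u t x * lap Φ x)
        - deriv θ t * ∫ x, timeDeriv T u t x * (damping μ β x * Φ x)) := by
  obtain ⟨ℓ₁, h₁⟩ := exists_clm_eq_integral_mul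
    (hΦ.continuous.memLp_of_hasCompactSupport (p := 2) (μ := volume) hc)
  obtain ⟨ℓ₂, h₂⟩ := exists_clm_eq_integral_mul
    ((continuous_lap hΦ).memLp_of_hasCompactSupport (p := 2) (μ := volume)
      (hasCompactSupport_lap hc))
  obtain ⟨ℓ₃, h₃⟩ := exists_clm_eq_integral_mul (ρ := fun x => damping μ β x * Φ x)
    (((continuous_damping μ β).mul hΦ.continuous).memLp_of_hasCompactSupport (p := 2)
      (μ := volume) hc.mul_left)
  have hθ' : ContDiff ℝ ∞ (deriv θ) := contDiff_infty_iff_deriv.1 hθ |>.2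
  have hθ'' : ContDiff ℝ ∞ (deriv (deriv θ)) := contDiff_infty_iff_deriv.1 hθ' |>.2
  have hvan : ∀ {F : ℝ → ℝ}, Continuous (deriv F) → (∀ t, S ≤ t → F t = 0) →
      ∀ t, S ≤ t → deriv F t = 0 := by
    intro F hF hFS t ht
    -- The endpoint `t = S` is reached by continuity from `t > S`.
    have : Set.EqOn (deriv F) 0 (closure (Set.Ioi S)) := by
      refine Set.EqOn.closure (fun s hs => ?_) hF continuous_const
      have : F =ᶠ[nhds s] fun _ => 0 := by
        filter_upwards [Ioi_mem_nhds hs] with r hr using hFS r (le_of_lt hr)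
      simp [this.deriv_eq]
    rw [closure_Ioi] at this
    exact this ht
  have hθS' := hvan hθ'.continuous hθS
  have hθS'' := hvan hθ''.continuous hθS'
  -- `θ` need not vanish for negative times; `χ` makes the support compact without changing anything
  -- on `t ≥ -1`.
  set χ : ℝ → ℝ := fun t => Real.smoothTransition (t + 2) with hχ
  have hχs : ContDiff ℝ ∞ χ :=
    Real.smoothTransition.contDiff.comp (contDiff_id.add contDiff_const)
  have hχ1 : ∀ t, -1 ≤ t → χ t = 1 := fun t ht =>
    Real.smoothTransition.one_of_one_le (by linarith)
  have hχ0 : ∀ t, t ≤ -2 → χ t = 0 := fun t ht =>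
    Real.smoothTransition.zero_of_nonpos (by linarith)
  set ξ : ℝ → ℝ := fun t => -(χ t * deriv θ t) with hξ
  have hξs : ContDiff ℝ ∞ ξ := (hχs.mul hθ').neg
  have hξ0 : ∀ t, 0 ≤ t → ξ t = -deriv θ t := fun t ht => by
    simp only [hξ]; rw [hχ1 t (by linarith), one_mul]
  have hξd : ∀ t, 0 < t → deriv ξ t = -deriv (deriv θ) t := fun t ht => by
    have : ξ =ᶠ[nhds t] fun s => -deriv θ s := by
      filter_upwards [Ioi_mem_nhds ht] with s hs using hξ0 s (le_of_lt hs)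
    rw [this.deriv_eq, deriv.fun_neg]
  have hξsupp : Function.support ξ ⊆ Set.Icc (-2) S := by
    intro t ht
    by_contra h
    refine ht ?_
    simp only [hξ]
    rcases lt_or_ge t (-2) with h1 | h1
    · rw [hχ0 t h1.le]; simp
    · rw [hθS' t (not_lt.1 fun h2 => h ⟨h1, h2.le⟩)]; simp
  set Ψ : ℝ × Rn n → ℝ := fun z => ξ z.1 * Φ z.2 with hΨ
  have hΨsupp : tsupport Ψ ⊆ Set.Icc (-2) S ×ˢ tsupport Φ := by
    refine closure_minimal (fun z hz => ?_) (isClosed_Icc.prod (isClosed_tsupport Φ))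
    exact ⟨hξsupp (left_ne_zero_of_mul hz), subset_tsupport Φ (right_ne_zero_of_mul hz)⟩
  have hw := hu.weak_form Ψ ((hξs.comp contDiff_fst).mul (hΦ.comp contDiff_snd))
    ((isCompact_Icc.prod hc).of_isClosed_subset (isClosed_tsupport _) hΨsupp)
    (fun z hz => ⟨(hΨsupp hz).1.2.trans_lt hST, trivial⟩)
  have hgrad : ∀ t x, gradient (fun y => Ψ (t, y)) x = ξ t • gradient Φ x := fun t x => by
    simp only [hΨ, gradient]
    rw [fderiv_const_mul ((hΦ.differentiable (by simp)) x), map_smul]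
  have hdt : ∀ t x, deriv (fun s => Ψ (s, x)) t = deriv ξ t * Φ x := fun t x => by
    simp only [hΨ]
    rw [deriv_mul_const ((hξs.differentiable (by simp)) t)]
  have t1 : ∫ x, g x * Ψ (0, x) = -deriv θ 0 * ∫ x, g x * Φ x := by
    rw [← hξ0 0 le_rfl, ← integral_const_mul]
    congr 1; ext x; simp only [hΨ]; ring
  have t2 : ∫ x, damping μ β x * H1.fn f x * Ψ (0, x) = -deriv θ 0 * ℓ₃ (H1.fn f) := by
    rw [← hξ0 0 le_rfl, h₃, ← integral_const_mul]
    congr 1; ext x; simp only [hΨ]; ring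
  have t3 : ∫ t in Set.Ioo 0 T, ∫ x, |timeDeriv T u t x| ^ p * Ψ (t, x)
      = -∫ t in 0..S, deriv θ t * ∫ x, |timeDeriv T u t x| ^ p * Φ x := by
    rw [← intervalIntegral.integral_neg, ← setIntegral_Ioo_eq_intervalIntegral hS.le hST
      (fun t ht => by rw [hθS' t ht]; simp)]
    refine setIntegral_congr_fun measurableSet_Ioo fun t ht => ?_
    beta_reduce
    rw [← neg_mul, ← hξ0 t ht.1.le, ← integral_const_mul]
    congr 1; ext x; simp only [hΨ]; ring
  have t4 : ∫ t in Set.Ioo 0 T, ∫ x, timeDeriv T u t x * deriv (fun s => Ψ (s, x)) t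
      = -∫ t in 0..S, deriv (deriv θ) t * ℓ₁ (timeDeriv T u t) := by
    rw [← intervalIntegral.integral_neg, ← setIntegral_Ioo_eq_intervalIntegral hS.le hST
      (fun t ht => by rw [hθS'' t ht]; simp)]
    refine setIntegral_congr_fun measurableSet_Ioo fun t ht => ?_
    beta_reduce
    rw [← neg_mul, ← hξd t ht.1, h₁, ← integral_const_mul]
    congr 1; ext x; rw [hdt]; ring
  have t5 : ∫ t in Set.Ioo 0 T, ∫ x,
        inner ℝ (H1.grad (u t) x) (gradient (fun y => Ψ (t, y)) x)
      = ∫ t in 0..S, deriv θ t * ℓ₂ (H1.fn (u t)) := by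
    rw [← setIntegral_Ioo_eq_intervalIntegral hS.le hST
      (fun t ht => by rw [hθS' t ht]; simp)]
    refine setIntegral_congr_fun measurableSet_Ioo fun t ht => ?_
    beta_reduce
    simp only [hgrad, inner_smul_right]
    rw [integral_const_mul, integral_inner_grad_gradient (u t) hΦ hc, h₂, hξ0 t ht.1.le]
    ring
  have t6 : ∫ t in Set.Ioo 0 T, ∫ x, damping μ β x * H1.fn (u t) x * deriv (fun s => Ψ (s, x)) t
      = -∫ t in 0..S, deriv (deriv θ) t * ℓ₃ (H1.fn (u t)) := by
    rw [← intervalIntegral.integral_neg, ← setIntegral_Ioo_eq_intervalIntegral hS.le hST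
      (fun t ht => by rw [hθS'' t ht]; simp)]
    refine setIntegral_congr_fun measurableSet_Ioo fun t ht => ?_
    beta_reduce
    rw [← neg_mul, ← hξd t ht.1, h₃, ← integral_const_mul]
    congr 1; ext x; rw [hdt]; ring
  rw [t1, t2, t3, t4, t5, t6, hu.integral_deriv_mul ℓ₂ hS hST hθ (hθS S le_rfl),
    hu.integral_deriv_mul ℓ₃ hS hST hθ' (hθS' S le_rfl)] at hw
  have hint : ∀ {F : ℝ → ℝ} (ℓ : L2 n →L[ℝ] ℝ), Continuous F →
      IntervalIntegrable (fun t => F t * ℓ (timeDeriv T u t)) volume 0 S := fun ℓ hF =>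
    ContinuousOn.intervalIntegrable (by
      rw [Set.uIcc_of_le hS.le]
      exact hF.continuousOn.mul (hu.continuousOn_clm_timeDeriv ℓ hST))
  simp only [← h₁, ← h₂, ← h₃]
  rw [intervalIntegral.integral_sub ((hint ℓ₁ hθ''.continuous).sub (hint ℓ₂ hθ.continuous))
    (hint ℓ₃ hθ'.continuous), intervalIntegral.integral_sub (hint ℓ₁ hθ''.continuous)
    (hint ℓ₂ hθ.continuous)]
  rw [← h₁ g] at hw
  linarith

end Time

/-! ### Mass of the profile over the light cone. -/

/-- In polar coordinates `r^{n-1} (1 + r)^{-m} ≤ (1 + r)^m`, because `n - 1 = 2m`; the exponential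
concentrates the integral at `r = t + 1`. -/
lemma exists_integral_weight_le {n : ℕ} (hn : 1 ≤ n) :
    ∃ C > (0 : ℝ), ∀ t : ℝ, 0 ≤ t →
      ∫ x in Metric.closedBall (0 : Rn n) (t + 1),
        (1 + ‖x‖) ^ (-(((n : ℝ) - 1) / 2)) * Real.exp ‖x‖
      ≤ C * ((1 + t) ^ (((n : ℝ) - 1) / 2) * Real.exp t) := by
  set m : ℝ := ((n : ℝ) - 1) / 2 with hm
  have hn' : (1 : ℝ) ≤ n := by exact_mod_cast hn
  have hm0 : 0 ≤ m := by rw [hm]; linarith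
  have : Nonempty (Fin n) := ⟨⟨0, hn⟩⟩
  set V : ℝ := (volume : Measure (Rn n)).real (Metric.ball 0 1) with hV
  have hV0 : 0 < V := ENNReal.toReal_pos (Metric.measure_ball_pos _ _ one_pos).ne' measure_ball_lt_top.ne
  refine ⟨n * V * (2 ^ m * Real.exp 1), by positivity, fun t ht => ?_⟩
  have h1 : ∫ x in Metric.closedBall (0 : Rn n) (t + 1), (1 + ‖x‖) ^ (-m) * Real.exp ‖x‖
      = n * V * ∫ r in Set.Ioc 0 (t + 1), r ^ (n - 1) * ((1 + r) ^ (-m) * Real.exp r) := by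
    have key := integral_fun_norm_addHaar (volume : Measure (Rn n))
      ((Set.Iic (t + 1)).indicator fun r : ℝ => (1 + r) ^ (-m) * Real.exp r)
    rw [finrank_euclideanSpace_fin] at key
    have e1 : (fun x : Rn n => (Set.Iic (t + 1)).indicator
        (fun r : ℝ => (1 + r) ^ (-m) * Real.exp r) ‖x‖)
        = (Metric.closedBall (0 : Rn n) (t + 1)).indicator
          (fun x => (1 + ‖x‖) ^ (-m) * Real.exp ‖x‖) := by
      ext x; simp [Set.indicator]
    have e2 : (fun r : ℝ => r ^ (n - 1) • (Set.Iic (t + 1)).indicator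
        (fun r : ℝ => (1 + r) ^ (-m) * Real.exp r) r)
        = (Set.Iic (t + 1)).indicator
          (fun r => r ^ (n - 1) * ((1 + r) ^ (-m) * Real.exp r)) := by
      ext r; simp [Set.indicator]
    rw [e1, e2, integral_indicator Metric.isClosed_closedBall.measurableSet,
      setIntegral_indicator measurableSet_Iic, Set.Ioi_inter_Iic] at key
    rw [key, nsmul_eq_mul, smul_eq_mul, mul_assoc]
  have h2 : ∫ r in Set.Ioc 0 (t + 1), r ^ (n - 1) * ((1 + r) ^ (-m) * Real.exp r)
      ≤ ∫ r in Set.Ioc 0 (t + 1), (2 ^ m * (1 + t) ^ m) * Real.exp r := by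
    have hint : IntegrableOn (fun r : ℝ => (2 ^ m * (1 + t) ^ m) * Real.exp r)
        (Set.Ioc 0 (t + 1)) :=
      ((continuous_const.mul Real.continuous_exp).continuousOn.integrableOn_Icc).mono_set
        Set.Ioc_subset_Icc_self
    refine setIntegral_mono_on₀ ?_ hint measurableSet_Ioc.nullMeasurableSet fun r hr => ?_
    · have : ContinuousOn (fun r : ℝ => r ^ (n - 1) * ((1 + r) ^ (-m) * Real.exp r))
          (Set.Icc 0 (t + 1)) := by
        refine ContinuousOn.mul (by fun_prop) (ContinuousOn.mul ?_ (by fun_prop))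
        exact ContinuousOn.rpow_const (by fun_prop) fun r hr =>
          Or.inl (by have := hr.1; positivity)
      exact this.integrableOn_Icc.mono_set Set.Ioc_subset_Icc_self
    · have hr0 : 0 < r := hr.1
      have e1 : r ^ (n - 1) ≤ (1 + r) ^ (m + m) := by
        have : ((n - 1 : ℕ) : ℝ) = m + m := by
          rw [Nat.cast_sub hn, hm]; push_cast; ring
        rw [← this, Real.rpow_natCast]
        gcongr; linarith
      have e2 : (1 + r) ^ (m + m) * (1 + r) ^ (-m) = (1 + r) ^ m := by
        rw [← Real.rpow_add (by linarith)]; congr 1; ring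
      have e3 : (1 + r) ^ m ≤ 2 ^ m * (1 + t) ^ m := by
        rw [← Real.mul_rpow two_pos.le (by linarith)]
        exact Real.rpow_le_rpow (by linarith) (by linarith [hr.2]) hm0
      calc r ^ (n - 1) * ((1 + r) ^ (-m) * Real.exp r)
          ≤ (1 + r) ^ (m + m) * ((1 + r) ^ (-m) * Real.exp r) := by gcongr
        _ = (1 + r) ^ m * Real.exp r := by rw [← mul_assoc, e2]
        _ ≤ _ := by gcongr
  have h3 : ∫ r in Set.Ioc 0 (t + 1), (2 ^ m * (1 + t) ^ m) * Real.exp r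
      ≤ (2 ^ m * (1 + t) ^ m) * (Real.exp t * Real.exp 1) := by
    rw [integral_const_mul, ← intervalIntegral.integral_of_le (by linarith), integral_exp,
      ← Real.exp_add]
    have := Real.exp_pos 0
    gcongr
    linarith
  rw [h1]
  calc (n : ℝ) * V * ∫ r in Set.Ioc 0 (t + 1), r ^ (n - 1) * ((1 + r) ^ (-m) * Real.exp r)
      ≤ n * V * ((2 ^ m * (1 + t) ^ m) * (Real.exp t * Real.exp 1)) := by
        gcongr; exact h2.trans h3
    _ = _ := by ring

/-! ### The Laplacian of a polynomial in `|x|²`. -/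

section Laplacian

variable {n : ℕ}

lemma lap_congr {Φ φ : Rn n → ℝ} {x : Rn n} (h : Φ =ᶠ[nhds x] φ) : lap Φ x = lap φ x := by
  have h1 : ∀ i, coordDeriv i Φ =ᶠ[nhds x] coordDeriv i φ := fun i => by
    filter_upwards [h.fderiv (𝕜 := ℝ)] with y hy
    simp only [coordDeriv, hy]
  refine Finset.sum_congr rfl fun i _ => ?_
  rw [coordDeriv, (h1 i).fderiv_eq, ← coordDeriv]

lemma coordDeriv_eval_norm_sq (G : Polynomial ℝ) (i : Fin n) (x : Rn n) :
    coordDeriv i (fun x : Rn n => G.eval (‖x‖ ^ 2)) x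
      = 2 * x i * G.derivative.eval (‖x‖ ^ 2) := by
  have h := (G.hasDerivAt (‖x‖ ^ 2)).comp_hasFDerivAt x
    (hasStrictFDerivAt_norm_sq x).hasFDerivAt
  rw [coordDeriv, HasFDerivAt.fderiv (f := fun x : Rn n => G.eval (‖x‖ ^ 2)) h]
  simp [EuclideanSpace.inner_single_right]
  ring

lemma lap_eval_norm_sq (G : Polynomial ℝ) (x : Rn n) :
    lap (fun x : Rn n => G.eval (‖x‖ ^ 2)) x = (radialLap n G).eval (‖x‖ ^ 2) := by
  have h1 : ∀ i, coordDeriv i (coordDeriv i fun x : Rn n => G.eval (‖x‖ ^ 2)) x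
      = 2 * G.derivative.eval (‖x‖ ^ 2)
        + 4 * (x i) ^ 2 * G.derivative.derivative.eval (‖x‖ ^ 2) := by
    intro i
    have e : coordDeriv i (fun x : Rn n => G.eval (‖x‖ ^ 2))
        = fun x => 2 * x i * G.derivative.eval (‖x‖ ^ 2) :=
      funext fun x => coordDeriv_eval_norm_sq G i x
    have d1 : HasFDerivAt (fun x : Rn n => 2 * x i) ((2 : ℝ) • EuclideanSpace.proj (𝕜 := ℝ) i) x :=
      ((EuclideanSpace.proj (𝕜 := ℝ) i).hasFDerivAt (x := x)).const_mul 2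
    have d2 := (G.derivative.hasDerivAt (‖x‖ ^ 2)).comp_hasFDerivAt x
      (hasStrictFDerivAt_norm_sq x).hasFDerivAt
    rw [e, coordDeriv, HasFDerivAt.fderiv
      (f := fun x : Rn n => 2 * x i * G.derivative.eval (‖x‖ ^ 2)) (d1.mul d2)]
    simp [EuclideanSpace.inner_single_right]
    ring
  simp only [lap, h1, Finset.sum_add_distrib, ← Finset.sum_mul, ← Finset.mul_sum,
    ← EuclideanSpace.real_norm_sq_eq]
  simp [radialLap]
  ring

end Laplacian

/-! ### Support and integrability of the time derivative. -/

section Solution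

variable {n : ℕ} {μ β p ε T : ℝ} {f : H1 n} {g : L2 n} {u : ℝ → H1 n}

lemma IsEnergySolution.continuousOn_integral_timeDeriv_mul
    (hu : IsEnergySolution μ β p f g ε T u) {ρ : Rn n → ℝ} (hρ : Continuous ρ)
    (hc : HasCompactSupport ρ) {S : ℝ} (hST : S < T) :
    ContinuousOn (fun t => ∫ x, timeDeriv T u t x * ρ x) (Set.Icc 0 S) := by
  obtain ⟨ℓ, h⟩ := exists_clm_eq_integral_mul
    (hρ.memLp_of_hasCompactSupport (p := 2) (μ := volume) hc)
  simp only [← h]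
  exact hu.continuousOn_clm_timeDeriv ℓ hST

/-- Finite propagation speed passes to the time derivative. -/
lemma IsEnergySolution.timeDeriv_eq_zero (hu : IsEnergySolution μ β p f g ε T u)
    (hs : HasConeSupport T u) {t : ℝ} (ht0 : 0 < t) (htT : t < T) :
    ∀ᵐ x : Rn n, t + 1 < ‖x‖ → timeDeriv T u t x = 0 := by
  set v := timeDeriv T u t with hv
  set A : Set (Rn n) := {x | t + 1 < ‖x‖} with hA
  have hAm : MeasurableSet A := measurableSet_lt measurable_const measurable_norm
  have hρ : MemLp (A.indicator v) 2 volume := (Lp.memLp v).indicator hAm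
  obtain ⟨ℓ, hℓ⟩ := exists_clm_eq_integral_mul hρ
  -- Only times `s ≤ t` are used, since the cone widens later. The left derivative at `t` then says
  -- that `u_t(t)²` has zero integral outside the ball.
  have hzero : ∀ s ∈ Set.Icc 0 t, ℓ (H1.fn (u s)) = 0 := by
    intro s hs'
    rw [hℓ]
    refine integral_eq_zero_of_ae ?_
    filter_upwards [hs s ⟨hs'.1, hs'.2.trans_lt htT⟩] with x hx
    by_cases hxA : x ∈ A
    · rw [hx (by have : t + 1 < ‖x‖ := hxA; linarith [hs'.2])]; simp
    · simp [hxA]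
  have hmem : t ∈ Set.Icc 0 t := ⟨ht0.le, le_rfl⟩
  have hd : HasDerivWithinAt (fun s => ℓ (H1.fn (u s))) (ℓ v) (Set.Icc 0 t) t :=
    (hu.hasDerivWithinAt ℓ ⟨ht0.le, htT⟩).mono fun s hs' => ⟨hs'.1, hs'.2.trans_lt htT⟩
  have hd0 : HasDerivWithinAt (fun s => ℓ (H1.fn (u s))) 0 (Set.Icc 0 t) t :=
    (hasDerivWithinAt_const t (Set.Icc 0 t) (0 : ℝ)).congr hzero (hzero t hmem)
  have hv0 : ℓ v = 0 := (uniqueDiffOn_Icc ht0 t hmem).eq_deriv _ hd hd0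
  rw [hℓ] at hv0
  have hint : Integrable fun x => v x * A.indicator v x :=
    (Lp.memLp v).integrable_mul hρ
  have hnn : 0 ≤ fun x => v x * A.indicator v x := fun x => by
    by_cases hxA : x ∈ A
    · simp [hxA, mul_self_nonneg]
    · simp [hxA]
  filter_upwards [(integral_eq_zero_iff_of_nonneg hnn hint).1 hv0] with x hx hxA
  have hxA' : x ∈ A := hxA
  simpa [hxA'] using hx

/-- Fatou along an almost everywhere convergent subsequence. This lower semicontinuity on `L²` makes
`∫ |u_t|^p Φ dx` measurable in `t`, although `u_t` is only a continuous curve in `L²`. -/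
lemma isClosed_setOf_lintegral_rpow_le (p : ℝ) (ρ : Rn n → ENNReal)
    (hρ : Measurable ρ) (hρ' : ∀ x, ρ x ≠ ⊤) (c : ENNReal) :
    IsClosed {w : L2 n | ∫⁻ x, ‖w x‖ₑ ^ p * ρ x ≤ c} := by
  refine IsSeqClosed.isClosed fun w v hw hv => ?_
  obtain ⟨ns, -, hns⟩ := (tendstoInMeasure_of_tendsto_Lp hv).exists_seq_tendsto_ae
  have hmeas : ∀ k, AEMeasurable (fun x => ‖w (ns k) x‖ₑ ^ p * ρ x) volume := fun k =>
    ((Lp.aestronglyMeasurable _).enorm.pow_const p).mul hρ.aemeasurable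
  calc ∫⁻ x, ‖v x‖ₑ ^ p * ρ x
      ≤ ∫⁻ x, Filter.liminf (fun k => ‖w (ns k) x‖ₑ ^ p * ρ x) Filter.atTop := by
        refine lintegral_mono_ae ?_
        filter_upwards [hns] with x hx
        refine le_of_eq (Filter.Tendsto.liminf_eq ?_).symm
        refine ENNReal.Tendsto.mul_const ?_ (Or.inr (hρ' x))
        exact (ENNReal.continuous_rpow_const.tendsto _).comp
          ((continuous_enorm.tendsto _).comp hx)
    _ ≤ Filter.liminf (fun k => ∫⁻ x, ‖w (ns k) x‖ₑ ^ p * ρ x) Filter.atTop :=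
        lintegral_liminf_le' hmeas
    _ ≤ Filter.liminf (fun _ : ℕ => c) Filter.atTop :=
        Filter.liminf_le_liminf (Filter.Eventually.of_forall fun k => hw (ns k))
    _ = c := Filter.liminf_const c

lemma IsEnergySolution.nonlinearity_integrable (hu : IsEnergySolution μ β p f g ε T u)
    (hp : 0 < p) {S : ℝ} (hS : 0 < S) (hST : S < T) {Φ : Rn n → ℝ} (hΦ : Continuous Φ)
    (hΦ0 : ∀ x, 0 ≤ Φ x) (hc : HasCompactSupport Φ) :
    IntegrableOn (fun t => ∫ x, |timeDeriv T u t x| ^ p * Φ x) (Set.Ioo 0 S) ∧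
      ∀ᵐ t ∂volume.restrict (Set.Ioo 0 S),
        Integrable fun x => |timeDeriv T u t x| ^ p * Φ x := by
  set ρ : Rn n → ENNReal := fun x => ENNReal.ofReal (Φ x) with hρ
  have hρm : Measurable ρ := hΦ.measurable.ennreal_ofReal
  set N : L2 n → ENNReal := fun w => ∫⁻ x, ‖w x‖ₑ ^ p * ρ x with hN
  obtain ⟨K, hK⟩ := hΦ.bounded_above_of_compact_support hc
  obtain ⟨R, hR⟩ := hc.isCompact.isBounded.subset_ball (0 : Rn n)
  have hρR : ∀ x, ρ x ≤ (Metric.ball (0 : Rn n) R).indicator (fun _ => ENNReal.ofReal K) x := by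
    intro x
    by_cases hx : x ∈ Metric.ball (0 : Rn n) R
    · rw [Set.indicator_of_mem hx]
      exact ENNReal.ofReal_le_ofReal ((le_abs_self _).trans (hK x))
    · have : Φ x = 0 := image_eq_zero_of_notMem_tsupport fun h => hx (hR h)
      simp [hρ, this]
  -- Extending the curve by constants makes it continuous on `ℝ`, so that the closed sublevel sets
  -- pull back to closed sets of times.
  have hcont : Continuous (Set.IccExtend hS.le fun t : Set.Icc 0 S => timeDeriv T u t) := by
    refine Continuous.Icc_extend' ?_
    exact continuousOn_iff_continuous_domRestrict.1 (hu.continuousOn_timeDeriv.mono fun t ht =>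
      ⟨ht.1, ht.2.trans_lt hST⟩)
  have hNm : AEMeasurable (fun t => N (timeDeriv T u t)) (volume.restrict (Set.Ioo 0 S)) := by
    refine ⟨fun t => N (Set.IccExtend hS.le (fun t : Set.Icc 0 S => timeDeriv T u t) t), ?_, ?_⟩
    · refine measurable_of_Iic fun c => ?_
      exact ((isClosed_setOf_lintegral_rpow_le p ρ hρm
        (fun x => ENNReal.ofReal_ne_top) c).preimage hcont).measurableSet
    · filter_upwards [ae_restrict_mem measurableSet_Ioo] with t ht
      rw [Set.IccExtend_of_mem hS.le _ (Set.Ioo_subset_Icc_self ht)]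
  have hNle : ∀ w : L2 n, N w
      ≤ ENNReal.ofReal K * ∫⁻ x in Metric.ball (0 : Rn n) R, ‖w x‖ₑ ^ p := by
    intro w
    rw [← lintegral_const_mul' _ _ ENNReal.ofReal_ne_top,
      ← lintegral_indicator Metric.isOpen_ball.measurableSet]
    refine lintegral_mono fun x => ?_
    refine (mul_le_mul_right (hρR x) _).trans (le_of_eq ?_)
    by_cases hx : x ∈ Metric.ball (0 : Rn n) R
    · simp only [Set.indicator_of_mem hx, mul_comm]
    · simp only [Set.indicator_of_notMem hx, mul_zero]
  have hfin : ∫⁻ t in Set.Ioo 0 S, N (timeDeriv T u t) ≠ ⊤ := by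
    refine ne_top_of_le_ne_top ?_ (lintegral_mono fun t => hNle (timeDeriv T u t))
    rw [lintegral_const_mul' _ _ ENNReal.ofReal_ne_top]
    exact ENNReal.mul_ne_top ENNReal.ofReal_ne_top (hu.locLp S hST R).ne
  have hof : ∀ (w : L2 n) x, ENNReal.ofReal (|w x| ^ p * Φ x) = ‖w x‖ₑ ^ p * ρ x := by
    intro w x
    rw [ENNReal.ofReal_mul (by positivity), ← ENNReal.ofReal_rpow_of_nonneg (abs_nonneg _) hp.le,
      ← Real.norm_eq_abs, ofReal_norm]
  have hnn : ∀ (w : L2 n), 0 ≤ᵐ[volume] fun x => |w x| ^ p * Φ x := fun w =>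
    Filter.Eventually.of_forall fun x => mul_nonneg (by positivity) (hΦ0 x)
  have hsm : ∀ w : L2 n, AEStronglyMeasurable (fun x => |w x| ^ p * Φ x) volume := fun w =>
    (((Lp.aestronglyMeasurable w).aemeasurable.abs.pow_const p).mul
      hΦ.aemeasurable).aestronglyMeasurable
  have heq : ∀ w : L2 n, ∫ x, |w x| ^ p * Φ x = (N w).toReal := fun w => by
    rw [integral_eq_lintegral_of_nonneg_ae (hnn w) (hsm w)]
    simp only [hof, hN]
  constructor
  · simp only [heq]
    exact integrable_toReal_of_lintegral_ne_top hNm hfin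
  · filter_upwards [ae_lt_top' hNm hfin] with t ht
    refine ⟨hsm _, ?_⟩
    rw [hasFiniteIntegral_iff_ofReal (hnn _)]
    simpa only [hof] using ht

end Solution

/-! ### Young's inequality and time cutoffs. -/

/-- Two derivatives of `h^{j+2}` leave only `h^j`. Since `j p ≥ j + 2` and `h ≤ 1`, the power
`h^{jp}` from Young's inequality is at most the full cutoff, so the first term can be absorbed. -/
lemma pow_mul_mul_le_add_rpow {p q : ℝ} (hpq : p.HolderConjugate q) {j : ℕ} (hj0 : 1 ≤ j)
    (hj : (j : ℝ) + 2 ≤ j * p) {h a b : ℝ} (h0 : 0 ≤ h) (h1 : h ≤ 1) (ha : 0 ≤ a) (hb : 0 ≤ b) :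
    h ^ j * a * b ≤ h ^ (j + 2) * a ^ p + b ^ q := by
  have y := Real.young_inequality_of_nonneg (mul_nonneg (pow_nonneg h0 j) ha) hb hpq
  have e1 : (h ^ j * a) ^ p ≤ h ^ (j + 2) * a ^ p := by
    rw [Real.mul_rpow (by positivity) ha]
    refine mul_le_mul_of_nonneg_right ?_ (by positivity)
    rcases h0.eq_or_lt with rfl | hpos
    · rw [zero_pow (by omega), Real.zero_rpow hpq.pos.ne']; positivity
    · rw [← Real.rpow_natCast, ← Real.rpow_mul h0, ← Real.rpow_natCast]
      exact Real.rpow_le_rpow_of_exponent_ge hpos h1 (by push_cast; linarith)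
  have e2 : (h ^ j * a) ^ p / p ≤ (h ^ j * a) ^ p := div_le_self (by positivity) hpq.lt.le
  have e3 : b ^ q / q ≤ b ^ q := div_le_self (by positivity) hpq.symm.lt.le
  linarith

/-- Powers of a smooth cutoff `H (lam t)`, with derivatives controlled by those of `lam`. -/
lemma exists_time_cutoff (j : ℕ) :
    ∃ K > (0 : ℝ), ∀ S > (0 : ℝ), ∀ lam w : ℝ → ℝ, ContDiff ℝ ∞ lam → lam 0 = 0 →
      (∀ t ∈ Set.Icc 0 S, lam t ∈ Set.Icc 0 1) → (∀ t, S ≤ t → 1 ≤ lam t) →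
      (∀ t ∈ Set.Ioo 0 S, 0 ≤ deriv lam t ∧ deriv lam t ≤ w t ∧ |deriv (deriv lam) t| ≤ w t ∧
        w t ≤ 4) →
      ∃ η h : ℝ → ℝ, ContDiff ℝ ∞ η ∧ (∀ t, 0 ≤ h t ∧ h t ≤ 1 ∧ η t = h t ^ (j + 2)) ∧
        η 0 = 1 ∧ deriv η 0 = 0 ∧ (∀ t, S ≤ t → η t = 0) ∧
        ∀ t ∈ Set.Ioo 0 S, deriv η t ≤ 0 ∧ |deriv η t| ≤ K * (h t ^ j * w t) ∧
          |deriv (deriv η) t| ≤ K * (h t ^ j * w t) := by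
  -- `H` is `1` for `s ≤ 1/2` and `0` for `s ≥ 1`; being constant near `0`, it gives `η'(0) = 0`.
  set H : ℝ → ℝ := fun s => Real.smoothTransition (2 - 2 * s) with hH
  have hHs : ContDiff ℝ ∞ H :=
    Real.smoothTransition.contDiff.comp (contDiff_const.sub (contDiff_const.mul contDiff_id))
  have hH' : ContDiff ℝ ∞ (deriv H) := (contDiff_infty_iff_deriv.1 hHs).2
  have hH'' : ContDiff ℝ ∞ (deriv (deriv H)) := (contDiff_infty_iff_deriv.1 hH').2
  have hHanti : Antitone H := fun a b hab => Real.smoothTransition.monotone (by linarith)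
  obtain ⟨D₁, hD₁⟩ := isCompact_Icc.exists_bound_of_continuousOn (s := Set.Icc (0 : ℝ) 1)
    hH'.continuous.continuousOn
  obtain ⟨D₂, hD₂⟩ := isCompact_Icc.exists_bound_of_continuousOn (s := Set.Icc (0 : ℝ) 1)
    hH''.continuous.continuousOn
  set D : ℝ := max D₁ D₂ with hD
  have hD0 : 0 ≤ D := le_max_of_le_left
    ((norm_nonneg _).trans (hD₁ 0 ⟨le_rfl, zero_le_one⟩))
  set J : ℝ := (j : ℝ) + 2 with hJ
  have hJ0 : 0 < J := by positivity
  refine ⟨J * D + J * J * (D * D * 4) + J * (5 * D) + 1, by positivity,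
    fun S hS lam w hlam hlam0 hlam1 hlamS hlamd => ?_⟩
  have hlam' : ContDiff ℝ ∞ (deriv lam) := (contDiff_infty_iff_deriv.1 hlam).2
  set h : ℝ → ℝ := fun t => H (lam t) with hh
  have hhs : ContDiff ℝ ∞ h := hHs.comp hlam
  have hd : ∀ t, HasDerivAt h (deriv H (lam t) * deriv lam t) t := fun t =>
    ((hHs.differentiable (by simp)) (lam t)).hasDerivAt.comp t
      ((hlam.differentiable (by simp)) t).hasDerivAt
  have hd' : ∀ t, HasDerivAt (fun t => deriv H (lam t) * deriv lam t)
      (deriv (deriv H) (lam t) * deriv lam t * deriv lam t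
        + deriv H (lam t) * deriv (deriv lam) t) t := fun t =>
    (((hH'.differentiable (by simp)) (lam t)).hasDerivAt.comp t
      ((hlam.differentiable (by simp)) t).hasDerivAt).mul
      ((hlam'.differentiable (by simp)) t).hasDerivAt
  have hη1 : ∀ t, HasDerivAt (fun t => h t ^ (j + 2))
      (J * h t ^ (j + 1) * (deriv H (lam t) * deriv lam t)) t := fun t => by
    refine ((hd t).fun_pow (j + 2)).congr_deriv ?_
    simp [hJ]
  have hη1' : deriv (fun t => h t ^ (j + 2))
      = fun t => J * h t ^ (j + 1) * (deriv H (lam t) * deriv lam t) :=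
    funext fun t => (hη1 t).deriv
  have hη2 : ∀ t, HasDerivAt (fun t => J * h t ^ (j + 1) * (deriv H (lam t) * deriv lam t))
      (J * (((j : ℝ) + 1) * h t ^ j * (deriv H (lam t) * deriv lam t))
          * (deriv H (lam t) * deriv lam t)
        + J * h t ^ (j + 1) * (deriv (deriv H) (lam t) * deriv lam t * deriv lam t
        + deriv H (lam t) * deriv (deriv lam) t)) t := fun t => by
    refine ((((hd t).fun_pow (j + 1)).const_mul J).mul (hd' t)).congr_deriv ?_
    simp
  have h01 : ∀ t, 0 ≤ h t ∧ h t ≤ 1 := fun t =>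
    ⟨Real.smoothTransition.nonneg _, Real.smoothTransition.le_one _⟩
  have hH0 : deriv H 0 = 0 := by
    have : H =ᶠ[nhds 0] fun _ => 1 := by
      filter_upwards [Iio_mem_nhds (show (0 : ℝ) < 1 / 2 by norm_num)] with s hs
      exact Real.smoothTransition.one_of_one_le (by have : s < 1 / 2 := hs; linarith)
    rw [this.deriv_eq]; simp
  refine ⟨fun t => h t ^ (j + 2), h, hhs.pow _, fun t => ⟨(h01 t).1, (h01 t).2, rfl⟩, ?_, ?_,
    fun t ht => ?_, fun t ht => ?_⟩
  · have : h 0 = 1 := Real.smoothTransition.one_of_one_le (by rw [hlam0]; norm_num)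
    simp [this]
  · rw [hη1']; simp [hlam0, hH0]
  · have : h t = 0 := Real.smoothTransition.zero_of_nonpos (by linarith [hlamS t ht])
    simp [this]
  · obtain ⟨l0, l1, l2, w4⟩ := hlamd t ht
    have hmem := hlam1 t (Set.Ioo_subset_Icc_self ht)
    have b1 : |deriv H (lam t)| ≤ D := (hD₁ _ hmem).trans (le_max_left _ _)
    have b2 : |deriv (deriv H) (lam t)| ≤ D := (hD₂ _ hmem).trans (le_max_right _ _)
    have hw0 : 0 ≤ w t := l0.trans l1
    have hab : |deriv lam t| ≤ w t := by rwa [abs_of_nonneg l0]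
    obtain ⟨g0, g1⟩ := h01 t
    have c1 : |deriv H (lam t) * deriv lam t| ≤ D * w t := by
      rw [abs_mul]; exact mul_le_mul b1 hab (abs_nonneg _) hD0
    have c2 : |deriv (deriv H) (lam t) * deriv lam t * deriv lam t
        + deriv H (lam t) * deriv (deriv lam) t| ≤ 5 * D * w t := by
      refine (abs_add_le _ _).trans ?_
      rw [abs_mul, abs_mul, abs_mul]
      -- The bound `w ≤ 4` turns the quadratic term `(lam')²` into one linear in `w`.
      have e1 : |deriv (deriv H) (lam t)| * |deriv lam t| * |deriv lam t| ≤ D * 4 * w t := by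
        gcongr; exact hab.trans w4
      have e2 : |deriv H (lam t)| * |deriv (deriv lam) t| ≤ D * w t := by gcongr
      linarith
    have hpow : h t ^ (j + 1) ≤ h t ^ j := pow_le_pow_of_le_one g0 g1 (by omega)
    have hX : 0 ≤ h t ^ j * w t := by positivity
    refine ⟨?_, ?_, ?_⟩
    · rw [hη1']
      exact mul_nonpos_of_nonneg_of_nonpos (by positivity)
        (mul_nonpos_of_nonpos_of_nonneg hHanti.deriv_nonpos l0)
    · rw [hη1']
      beta_reduce
      rw [abs_mul, abs_of_nonneg (show 0 ≤ J * h t ^ (j + 1) by positivity)]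
      calc J * h t ^ (j + 1) * |deriv H (lam t) * deriv lam t|
          ≤ J * h t ^ j * (D * w t) := by gcongr
        _ = J * D * (h t ^ j * w t) := by ring
        _ ≤ _ := by
          refine mul_le_mul_of_nonneg_right ?_ hX
          nlinarith [mul_nonneg hJ0.le hD0, mul_nonneg (mul_nonneg hJ0.le hJ0.le)
            (mul_nonneg hD0 hD0)]
    · rw [hη1', (hη2 t).deriv]
      refine (abs_add_le _ _).trans ?_
      generalize deriv H (lam t) * deriv lam t = P at c1 ⊢
      generalize deriv (deriv H) (lam t) * deriv lam t * deriv lam t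
        + deriv H (lam t) * deriv (deriv lam) t = Q at c2 ⊢
      have hD4 : D * w t ≤ D * 4 := by gcongr
      have e1 : |J * (((j : ℝ) + 1) * h t ^ j * P) * P| ≤ J * J * (D * D * 4) * (h t ^ j * w t) := by
        have : J * (((j : ℝ) + 1) * h t ^ j * P) * P = J * (j + 1) * h t ^ j * (P * P) := by ring
        rw [this, abs_mul, abs_mul P, abs_of_nonneg (by positivity)]
        calc J * (j + 1) * h t ^ j * (|P| * |P|)
            ≤ J * J * h t ^ j * ((D * w t) * (D * 4)) := by
              have : (j : ℝ) + 1 ≤ J := by rw [hJ]; linarith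
              gcongr
              exact c1.trans hD4
          _ = _ := by ring
      have e2 : |J * h t ^ (j + 1) * Q| ≤ J * (5 * D) * (h t ^ j * w t) := by
        rw [abs_mul, abs_of_nonneg (by positivity)]
        calc J * h t ^ (j + 1) * |Q| ≤ J * h t ^ j * (5 * D * w t) := by gcongr
          _ = _ := by ring
      have e3 : 0 ≤ J * D * (h t ^ j * w t) := by positivity
      linarith

/-! ### The lifespan inequality. -/

/-- The parameters `η₁`, `η₂` stand for `η'`, `η''`, and `h^{j+2}` for `η`; the factor `e^{-t}` is
removed. The undifferentiated terms combine to `-η (ΔΦ - (1 + a) Φ)`, of size at most `η δ ≤ h^j w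
Φ` since `Φ ≥ 1` on the support of `v`. All coefficients are thus `O(h^j w Φ)`, and Young's
inequality applies pointwise. -/
lemma spatial_estimate {n : ℕ} {μ β p q : ℝ} (hpq : p.HolderConjugate q) (hμ : 0 < μ)
    (hβ : 2 < β) {G : Polynomial ℝ} {R δ : ℝ} (hδ : 0 ≤ δ)
    (hG : ∀ r ∈ Set.Ico 0 R, 1 ≤ G.eval (r ^ 2) ∧
      |(radialLap n G).eval (r ^ 2) - (1 + μ / (1 + r) ^ β) * G.eval (r ^ 2)| ≤ δ)
    {Φ : Rn n → ℝ} (hΦ : ContDiff ℝ ∞ Φ) (hc : HasCompactSupport Φ) (hΦ0 : ∀ x, 0 ≤ Φ x)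
    (hΦG : ∀ x, ‖x‖ < R → Φ x = G.eval (‖x‖ ^ 2)) {t : ℝ} (htR : t + 1 < R) {v : L2 n}
    (hv : ∀ᵐ x, t + 1 < ‖x‖ → v x = 0) (hvp : Integrable fun x => |v x| ^ p * Φ x)
    {j : ℕ} (hj0 : 1 ≤ j) (hj : (j : ℝ) + 2 ≤ j * p) {h w K η₁ η₂ : ℝ} (h0 : 0 ≤ h)
    (h1 : h ≤ 1) (hK : 0 ≤ K) (hδw : δ ≤ w) (hη₁ : |η₁| ≤ K * (h ^ j * w))
    (hη₂ : |η₂| ≤ K * (h ^ j * w)) :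
    (η₂ - 2 * η₁ + h ^ (j + 2)) * (∫ x, v x * Φ x) - h ^ (j + 2) * (∫ x, v x * lap Φ x)
        - (η₁ - h ^ (j + 2)) * (∫ x, v x * (damping μ β x * Φ x))
      ≤ h ^ (j + 2) * (∫ x, |v x| ^ p * Φ x)
        + ((K * (3 + μ) + 1) * w) ^ q * ∫ x in Metric.closedBall (0 : Rn n) (t + 1), Φ x := by
  have hvl : LocallyIntegrable (v : Rn n → ℝ) := (Lp.memLp v).locallyIntegrable (by norm_num)
  have i1 : Integrable fun x => v x * Φ x :=
    hvl.integrable_smul_right_of_hasCompactSupport hΦ.continuous hc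
  have i2 : Integrable fun x => v x * lap Φ x :=
    hvl.integrable_smul_right_of_hasCompactSupport (continuous_lap hΦ) (hasCompactSupport_lap hc)
  have i3 : Integrable fun x => v x * (damping μ β x * Φ x) :=
    hvl.integrable_smul_right_of_hasCompactSupport
      ((continuous_damping μ β).mul hΦ.continuous) hc.mul_left
  have i4 : Integrable ((Metric.closedBall (0 : Rn n) (t + 1)).indicator Φ) :=
    (hΦ.continuous.integrable_of_hasCompactSupport hc).indicator
      Metric.isClosed_closedBall.measurableSet
  have hw0 : 0 ≤ w := hδ.trans hδw
  have i12 : Integrable fun x => (η₂ - 2 * η₁ + h ^ (j + 2)) * (v x * Φ x)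
      - h ^ (j + 2) * (v x * lap Φ x) := (i1.const_mul _).sub (i2.const_mul _)
  rw [← integral_indicator Metric.isClosed_closedBall.measurableSet, ← integral_const_mul,
    ← integral_const_mul, ← integral_const_mul, ← integral_const_mul, ← integral_const_mul,
    ← integral_sub (i1.const_mul _) (i2.const_mul _),
    ← integral_sub i12 (i3.const_mul _),
    ← integral_add (hvp.const_mul _) (i4.const_mul _)]
  refine integral_mono_ae (i12.sub (i3.const_mul _))
    ((hvp.const_mul _).add (i4.const_mul _)) ?_
  filter_upwards [hv] with x hx
  by_cases hxt : t + 1 < ‖x‖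
  · rw [hx hxt]
    have : x ∉ Metric.closedBall (0 : Rn n) (t + 1) := by simpa using hxt
    simp [this, Real.zero_rpow hpq.pos.ne']
  · have hmem : x ∈ Metric.closedBall (0 : Rn n) (t + 1) := by simpa using hxt
    have hxR : ‖x‖ < R := by linarith
    rw [Set.indicator_of_mem hmem]
    have hloc : Φ =ᶠ[nhds x] fun x => G.eval (‖x‖ ^ 2) := by
      filter_upwards [(continuous_norm.isOpen_preimage _ isOpen_Iio).mem_nhds hxR] with y hy
      exact hΦG y hy
    have hlap : lap Φ x = (radialLap n G).eval (‖x‖ ^ 2) := by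
      rw [lap_congr hloc, lap_eval_norm_sq]
    obtain ⟨g1, g2⟩ := hG ‖x‖ ⟨norm_nonneg x, hxR⟩
    rw [← hlap, ← hΦG x hxR] at g2
    rw [← hΦG x hxR] at g1
    have ha0 : 0 ≤ damping μ β x := by unfold damping; positivity
    have haμ : damping μ β x ≤ μ := div_le_self hμ.le
      (Real.one_le_rpow (by linarith [norm_nonneg x]) (by linarith))
    change |lap Φ x - (1 + damping μ β x) * Φ x| ≤ δ at g2
    set a := damping μ β x
    set X := h ^ j * w with hX
    have hX0 : 0 ≤ X := by positivity
    have hcoef : |(η₂ - 2 * η₁ - a * η₁) * Φ x - h ^ (j + 2) * (lap Φ x - (1 + a) * Φ x)|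
        ≤ (K * (3 + μ) + 1) * X * Φ x := by
      refine (abs_sub _ _).trans ?_
      have e1 : |(η₂ - 2 * η₁ - a * η₁) * Φ x| ≤ K * (3 + μ) * X * Φ x := by
        rw [abs_mul, abs_of_nonneg (hΦ0 x)]
        refine mul_le_mul_of_nonneg_right ?_ (hΦ0 x)
        have d1 : |η₂ - 2 * η₁ - a * η₁| ≤ |η₂| + 2 * |η₁| + a * |η₁| := by
          refine (abs_sub _ _).trans (add_le_add ((abs_sub _ _).trans ?_) ?_)
          · rw [abs_mul, abs_two]
          · rw [abs_mul, abs_of_nonneg ha0]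
        have d2 : a * |η₁| ≤ μ * (K * X) := by gcongr
        linarith
      have e2 : |h ^ (j + 2) * (lap Φ x - (1 + a) * Φ x)| ≤ X * Φ x := by
        rw [abs_mul, abs_of_nonneg (by positivity)]
        have d1 : h ^ (j + 2) ≤ h ^ j := pow_le_pow_of_le_one h0 h1 (by omega)
        calc h ^ (j + 2) * |lap Φ x - (1 + a) * Φ x| ≤ h ^ j * w := by
              gcongr; exact g2.trans hδw
          _ ≤ X * Φ x := le_mul_of_one_le_right hX0 g1
      linarith
    have hy := pow_mul_mul_le_add_rpow hpq hj0 hj h0 h1 (abs_nonneg (v x))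
      (show 0 ≤ (K * (3 + μ) + 1) * w by positivity)
    calc (η₂ - 2 * η₁ + h ^ (j + 2)) * (v x * Φ x) - h ^ (j + 2) * (v x * lap Φ x)
          - (η₁ - h ^ (j + 2)) * (v x * (a * Φ x))
        = v x * ((η₂ - 2 * η₁ - a * η₁) * Φ x - h ^ (j + 2) * (lap Φ x - (1 + a) * Φ x)) := by
          ring
      _ ≤ |v x| * ((K * (3 + μ) + 1) * X * Φ x) := by
          refine (le_abs_self _).trans ?_
          rw [abs_mul]; gcongr
      _ = (h ^ j * |v x| * ((K * (3 + μ) + 1) * w)) * Φ x := by rw [hX]; ring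
      _ ≤ (h ^ (j + 2) * |v x| ^ p + ((K * (3 + μ) + 1) * w) ^ q) * Φ x :=
          mul_le_mul_of_nonneg_right hy (hΦ0 x)
      _ = _ := by ring

/-- The basic lifespan inequality: `lam` parametrizes the time cutoff and `w` bounds its
derivatives. -/
lemma exists_lifespan_inequality {n : ℕ} (hn : 1 ≤ n) {μ β p q : ℝ} (hμ : 0 < μ) (hβ : 2 < β)
    (hpq : p.HolderConjugate q) :
    ∃ C > (0 : ℝ), ∀ (f : H1 n) (g : L2 n), (∀ᵐ x : Rn n, 0 ≤ H1.fn f x) →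
      (∀ᵐ x : Rn n, 0 ≤ g x) → (∀ᵐ x : Rn n, 1 < ‖x‖ → H1.fn f x = 0) →
      ∀ ε > (0 : ℝ), ∀ (T : ℝ) (u : ℝ → H1 n), IsEnergySolution μ β p f g ε T u →
      HasConeSupport T u → ∀ S > (0 : ℝ), S < T → ∀ lam w : ℝ → ℝ, ContDiff ℝ ∞ lam →
      lam 0 = 0 → (∀ t ∈ Set.Icc 0 S, lam t ∈ Set.Icc 0 1) → (∀ t, S ≤ t → 1 ≤ lam t) →
      (∀ t ∈ Set.Ioo 0 S, 0 ≤ deriv lam t ∧ deriv lam t ≤ w t ∧ |deriv (deriv lam) t| ≤ w t ∧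
        w t ≤ 4) → ContinuousOn w (Set.Icc 0 S) → (∀ t ∈ Set.Icc 0 S, 0 < w t) →
      ε * ∫ x in Metric.closedBall (0 : Rn n) 1, g x
        ≤ C * ∫ t in 0..S, w t ^ q * (1 + t) ^ (((n : ℝ) - 1) / 2) := by
  obtain ⟨j, hj0, hj⟩ : ∃ j : ℕ, 1 ≤ j ∧ (j : ℝ) + 2 ≤ j * p := by
    obtain ⟨j, hj⟩ := exists_nat_ge (2 / (p - 1))
    have hp1 := hpq.sub_one_pos
    refine ⟨j + 1, by omega, ?_⟩
    rw [div_le_iff₀ hp1] at hj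
    push_cast
    nlinarith
  obtain ⟨K, hK, hcut⟩ := exists_time_cutoff j
  obtain ⟨Cp, hCp, hprof⟩ := exists_radial_profile hn hμ hβ
  obtain ⟨Cw, hCw, hweight⟩ := exists_integral_weight_le hn
  set m : ℝ := ((n : ℝ) - 1) / 2 with hm
  refine ⟨(K * (3 + μ) + 1) ^ q * (Cp * Cw), by positivity, ?_⟩
  intro f g hf0 hg0 hfs ε hε T u hu hcone S hS hST lam w hlam hlam0 hlam1 hlamS hlamd hwc hw0
  obtain ⟨η, h, hηs, hηh, hη0, hη0', hηS, hηd⟩ := hcut S hS lam w hlam hlam0 hlam1 hlamS hlamd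
  -- The minimum of `w` is positive and serves as the profile error `δ`; the constants of the
  -- profile do not depend on it.
  obtain ⟨t₀, ht₀, hmin⟩ := isCompact_Icc.exists_isMinOn (Set.nonempty_Icc.2 hS.le) hwc
  obtain ⟨G, hG⟩ := hprof (S + 3) (by linarith) (w t₀) (hw0 t₀ ht₀)
  -- The solution lives in `|x| ≤ S + 1` up to time `S`, so this truncation is never seen by `u_t`.
  set ζ : ContDiffBump (0 : Rn n) := ⟨S + 2, S + 3, by linarith, by linarith⟩ with hζ
  set Φ : Rn n → ℝ := fun x => ζ x * G.eval (‖x‖ ^ 2) with hΦdef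
  have hGs : ContDiff ℝ ∞ fun x : Rn n => G.eval (‖x‖ ^ 2) := by
    have h1 : ContDiff ℝ ∞ fun s : ℝ => G.eval s := by
      simpa using G.contDiff_aeval (𝕜 := ℝ) ∞
    exact h1.comp (contDiff_norm_sq ℝ)
  have hΦ : ContDiff ℝ ∞ Φ := ζ.contDiff.mul hGs
  have hc : HasCompactSupport Φ := ζ.hasCompactSupport.mul_right
  have hΦG : ∀ x : Rn n, ‖x‖ < S + 2 → Φ x = G.eval (‖x‖ ^ 2) := fun x hx => by
    have : ζ x = 1 := ζ.one_of_mem_closedBall (by simpa using hx.le)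
    simp only [hΦdef, this, one_mul]
  have hΦ0 : ∀ x, 0 ≤ Φ x := fun x => by
    rcases lt_or_ge ‖x‖ (S + 3) with hx | hx
    · exact mul_nonneg ζ.nonneg (by linarith [(hG ‖x‖ ⟨norm_nonneg x, hx.le⟩).1])
    · have : ζ x = 0 := ζ.zero_of_le_dist (by simpa using hx)
      simp [hΦdef, this]
  have hlapΦ : ∀ x : Rn n, ‖x‖ < S + 2 → lap Φ x = (radialLap n G).eval (‖x‖ ^ 2) :=
      fun x hx => by
    rw [← lap_eval_norm_sq]
    refine lap_congr ?_
    filter_upwards [(continuous_norm.isOpen_preimage _ isOpen_Iio).mem_nhds hx] with y hy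
    exact hΦG y hy
  set θ : ℝ → ℝ := fun t => η t * Real.exp (-t) with hθdef
  have hθ : ContDiff ℝ ∞ θ := hηs.mul (Real.contDiff_exp.comp contDiff_neg)
  have hηs' : ContDiff ℝ ∞ (deriv η) := (contDiff_infty_iff_deriv.1 hηs).2
  have hexp : ∀ t : ℝ, HasDerivAt (fun t => Real.exp (-t)) (-Real.exp (-t)) t := fun t => by
    simpa using (hasDerivAt_neg t).exp
  have hθ1 : deriv θ = fun t => (deriv η t - η t) * Real.exp (-t) := by
    funext t
    rw [(((hηs.differentiable (by simp)) t).hasDerivAt.fun_mul (hexp t)).deriv]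
    ring
  have hθ2 : deriv (deriv θ)
      = fun t => (deriv (deriv η) t - 2 * deriv η t + η t) * Real.exp (-t) := by
    rw [hθ1]
    funext t
    rw [((((hηs'.differentiable (by simp)) t).hasDerivAt.fun_sub
      ((hηs.differentiable (by simp)) t).hasDerivAt).fun_mul (hexp t)).deriv]
    ring
  have hθ' : ContDiff ℝ ∞ (deriv θ) := (contDiff_infty_iff_deriv.1 hθ).2
  have hθ'' : ContDiff ℝ ∞ (deriv (deriv θ)) := (contDiff_infty_iff_deriv.1 hθ').2
  have hid := hu.identity hS hST hθ (fun t ht => by simp [hθdef, hηS t ht]) hΦ hc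
  have hθ10 : deriv θ 0 = -1 := by rw [hθ1]; simp [hη0, hη0']
  have hθ00 : θ 0 = 1 := by simp [hθdef, hη0]
  rw [hθ10, hθ00, neg_neg, one_mul, one_mul] at hid
  set N : ℝ → ℝ := fun t => ∫ x, |timeDeriv T u t x| ^ p * Φ x with hN
  obtain ⟨hNint, hNae⟩ := hu.nonlinearity_integrable hpq.pos hS hST hΦ.continuous hΦ0 hc
  have hN0 : ∀ t, 0 ≤ N t := fun t =>
    integral_nonneg fun x => mul_nonneg (by positivity) (hΦ0 x)
  -- `f` is supported in the unit ball, where `ΔΦ ≥ 1`.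
  have hf_term : 0 ≤ ∫ x, H1.fn f x * lap Φ x := by
    refine integral_nonneg_of_ae ?_
    filter_upwards [hf0, hfs] with x h1 h2
    rcases le_or_gt ‖x‖ 1 with hx | hx
    · refine mul_nonneg h1 ?_
      rw [hlapΦ x (by linarith)]
      linarith [(hG ‖x‖ ⟨norm_nonneg x, by linarith⟩).2.2.1]
    · simp [h2 hx]
  have hg_term : ∫ x in Metric.closedBall (0 : Rn n) 1, g x ≤ ∫ x, g x * Φ x := by
    have hgl : LocallyIntegrable (g : Rn n → ℝ) := (Lp.memLp g).locallyIntegrable (by norm_num)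
    rw [← integral_indicator Metric.isClosed_closedBall.measurableSet]
    refine integral_mono_ae ?_ (hgl.integrable_smul_right_of_hasCompactSupport hΦ.continuous hc) ?_
    · exact (integrable_indicator_iff Metric.isClosed_closedBall.measurableSet).2
        (hgl.integrableOn_isCompact (isCompact_closedBall _ _))
    · filter_upwards [hg0] with x hx
      by_cases hxb : x ∈ Metric.closedBall (0 : Rn n) 1
      · rw [Set.indicator_of_mem hxb]
        have hx1 : ‖x‖ ≤ 1 := by simpa using hxb
        refine le_mul_of_one_le_right hx ?_
        rw [hΦG x (by linarith)]
        exact (hG ‖x‖ ⟨norm_nonneg x, by linarith⟩).1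
      · rw [Set.indicator_of_notMem hxb]
        exact mul_nonneg hx (hΦ0 x)
  have hball : ∀ t ∈ Set.Ioo 0 S, ∫ x in Metric.closedBall (0 : Rn n) (t + 1), Φ x
      ≤ Cp * Cw * ((1 + t) ^ m * Real.exp t) := by
    intro t ht
    calc ∫ x in Metric.closedBall (0 : Rn n) (t + 1), Φ x
        ≤ ∫ x in Metric.closedBall (0 : Rn n) (t + 1),
            Cp * ((1 + ‖x‖) ^ (-m) * Real.exp ‖x‖) := by
          have hpos : ∀ x : Rn n, 1 + ‖x‖ ≠ 0 := fun x => by positivity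
          refine setIntegral_mono_on
            (hΦ.continuous.continuousOn.integrableOn_compact (isCompact_closedBall _ _))
            (Continuous.continuousOn ?_ |>.integrableOn_compact (isCompact_closedBall _ _))
            Metric.isClosed_closedBall.measurableSet fun x hx => ?_
          · exact continuous_const.mul ((Continuous.rpow_const (by fun_prop)
              fun x => Or.inl (hpos x)).mul (by fun_prop))
          · have hxt : ‖x‖ ≤ t + 1 := by simpa using hx
            rw [hΦG x (by linarith [ht.2])]
            exact (hG ‖x‖ ⟨norm_nonneg x, by linarith [ht.2]⟩).2.1
      _ ≤ _ := by
          rw [integral_const_mul, mul_assoc]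
          exact mul_le_mul_of_nonneg_left (hweight t ht.1.le) hCp.le
  set I : ℝ → ℝ := fun t => deriv (deriv θ) t * (∫ x, timeDeriv T u t x * Φ x)
        - θ t * (∫ x, timeDeriv T u t x * lap Φ x)
        - deriv θ t * ∫ x, timeDeriv T u t x * (damping μ β x * Φ x) with hI
  have hIc : ContinuousOn I (Set.Icc 0 S) :=
    ((hθ''.continuous.continuousOn.mul
        (hu.continuousOn_integral_timeDeriv_mul hΦ.continuous hc hST)).sub
      (hθ.continuous.continuousOn.mul (hu.continuousOn_integral_timeDeriv_mul
        (continuous_lap hΦ) (hasCompactSupport_lap hc) hST))).sub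
      (hθ'.continuous.continuousOn.mul (hu.continuousOn_integral_timeDeriv_mul
        ((continuous_damping μ β).mul hΦ.continuous) hc.mul_left hST))
  have hIint : IntegrableOn I (Set.Ioo 0 S) :=
    hIc.integrableOn_Icc.mono_set Set.Ioo_subset_Icc_self
  have hθN : IntegrableOn (fun t => deriv θ t * N t) (Set.Ioo 0 S) :=
    hNint.continuousOn_mul_of_subset hθ'.continuous.continuousOn isCompact_Icc measurableSet_Ioo
      Set.Ioo_subset_Icc_self
  have hwint : IntegrableOn (fun t => (K * (3 + μ) + 1) ^ q * (Cp * Cw)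
      * (w t ^ q * (1 + t) ^ m)) (Set.Ioo 0 S) := by
    refine (ContinuousOn.integrableOn_Icc ?_).mono_set Set.Ioo_subset_Icc_self
    refine continuousOn_const.mul ((hwc.rpow_const fun t ht => Or.inl (hw0 t ht).ne').mul ?_)
    exact ContinuousOn.rpow_const (by fun_prop) fun t ht => Or.inl (by linarith [ht.1])
  -- The nonlinear term carries the weight `-θ' = (η - η') e^{-t}`. The part `η e^{-t}` absorbs the
  -- Young term, and `-η' ≥ 0` lets the rest be dropped.
  have hpoint : ∀ᵐ t ∂volume.restrict (Set.Ioo 0 S), I t + deriv θ t * N t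
      ≤ (K * (3 + μ) + 1) ^ q * (Cp * Cw) * (w t ^ q * (1 + t) ^ m) := by
    filter_upwards [hNae, ae_restrict_mem measurableSet_Ioo] with t htN ht
    obtain ⟨d1, d2, d3⟩ := hηd t ht
    obtain ⟨h0, h1, hηt⟩ := hηh t
    have htI : t ∈ Set.Icc 0 S := Set.Ioo_subset_Icc_self ht
    have hsp := spatial_estimate hpq hμ hβ (hw0 t₀ ht₀).le
      (fun r hr => ⟨(hG r ⟨hr.1, by linarith [hr.2]⟩).1, (hG r ⟨hr.1, by linarith [hr.2]⟩).2.2.2⟩)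
      hΦ hc hΦ0 hΦG (by linarith [ht.2])
      (hu.timeDeriv_eq_zero hcone ht.1 (ht.2.trans hST)) htN hj0 hj h0 h1 hK.le (hmin htI) d2 d3
    rw [← hηt] at hsp
    have hIeq : I t = Real.exp (-t) * ((deriv (deriv η) t - 2 * deriv η t + η t)
          * (∫ x, timeDeriv T u t x * Φ x) - η t * (∫ x, timeDeriv T u t x * lap Φ x)
        - (deriv η t - η t) * (∫ x, timeDeriv T u t x * (damping μ β x * Φ x))) := by
      simp only [hI]
      rw [hθ2, hθ1]
      simp only [hθdef]
      ring
    have hwq : ((K * (3 + μ) + 1) * w t) ^ q = (K * (3 + μ) + 1) ^ q * w t ^ q :=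
      Real.mul_rpow (by positivity) (hw0 t htI).le
    have hwt := hw0 t htI
    have hee : Real.exp (-t) * Real.exp t = 1 := by rw [← Real.exp_add]; simp
    have hNt : deriv η t * N t ≤ 0 := mul_nonpos_of_nonpos_of_nonneg d1 (hN0 t)
    calc I t + deriv θ t * N t
        ≤ Real.exp (-t) * (η t * N t + ((K * (3 + μ) + 1) * w t) ^ q
              * ∫ x in Metric.closedBall (0 : Rn n) (t + 1), Φ x)
            + (deriv η t - η t) * Real.exp (-t) * N t := by
          rw [hIeq, hθ1]
          exact add_le_add_left (mul_le_mul_of_nonneg_left hsp (Real.exp_pos _).le) _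
      _ = Real.exp (-t) * (deriv η t * N t) + Real.exp (-t) * (((K * (3 + μ) + 1) * w t) ^ q
              * ∫ x in Metric.closedBall (0 : Rn n) (t + 1), Φ x) := by ring
      _ ≤ 0 + Real.exp (-t) * (((K * (3 + μ) + 1) * w t) ^ q
              * (Cp * Cw * ((1 + t) ^ m * Real.exp t))) := by
          refine add_le_add (mul_nonpos_of_nonneg_of_nonpos (Real.exp_pos _).le hNt) ?_
          have := hball t ht
          gcongr
      _ = _ := by
          rw [hwq]
          linear_combination ((K * (3 + μ) + 1) ^ q * w t ^ q * (Cp * Cw * (1 + t) ^ m)) * hee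
  have hfinal := integral_mono_ae (hIint.add hθN) hwint hpoint
  have hsum : ∫ t in Set.Ioo 0 S, (I t + deriv θ t * N t)
      = (∫ t in Set.Ioo 0 S, I t) + ∫ t in Set.Ioo 0 S, deriv θ t * N t :=
    integral_add hIint hθN
  have hconv : ∀ F : ℝ → ℝ, ∫ t in 0..S, F t = ∫ t in Set.Ioo 0 S, F t := fun F => by
    rw [intervalIntegral.integral_of_le hS.le, integral_Ioc_eq_integral_Ioo]
  rw [← intervalIntegral.integral_const_mul, hconv]
  rw [hconv, hconv] at hid
  have e1 : ε * ∫ x in Metric.closedBall (0 : Rn n) 1, g x ≤ ε * ∫ x, g x * Φ x := by gcongr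
  have e2 : 0 ≤ ε * ∫ x, H1.fn f x * lap Φ x := by positivity
  have hfinal' : (∫ t in Set.Ioo 0 S, (I t + deriv θ t * N t)) ≤ _ := hfinal
  linarith

/-! ### The linear and logarithmic cutoffs, and the exponents. -/

lemma integral_linear_weight_le {S m q : ℝ} (hS : 1 ≤ S) (hm : 0 ≤ m) :
    ∫ t in 0..S, (1 / S) ^ q * (1 + t) ^ m ≤ 2 ^ m * S ^ (m + 1 - q) := by
  have hS0 : 0 < S := by linarith
  have h1 : ∫ t in 0..S, (1 / S) ^ q * (1 + t) ^ m ≤ ∫ _ in 0..S, (1 / S) ^ q * (2 * S) ^ m := by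
    refine intervalIntegral.integral_mono_on hS0.le (ContinuousOn.intervalIntegrable ?_)
      (continuous_const.intervalIntegrable _ _) fun t ht => ?_
    · rw [Set.uIcc_of_le hS0.le]
      exact continuousOn_const.mul (ContinuousOn.rpow_const (by fun_prop)
        fun t ht => Or.inl (by linarith [ht.1]))
    · have := ht.1
      have := ht.2
      gcongr
      linarith
  refine h1.trans (le_of_eq ?_)
  rw [intervalIntegral.integral_const, smul_eq_mul, sub_zero, one_div, Real.inv_rpow hS0.le,
    Real.mul_rpow two_pos.le hS0.le, Real.rpow_sub hS0, Real.rpow_add hS0, Real.rpow_one]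
  ring

/-- When `m = q - 1` the powers of `1 + t` combine to `(1 + t)⁻¹`, whose integral `log (1 + S)` is
at most `L`. -/
lemma integral_log_weight_le {S L m q : ℝ} (hS : 1 ≤ S) (hL : L = Real.log (1 + S ^ 2))
    (hm : m = q - 1) :
    ∫ t in 0..S, (4 / ((1 + t) * L)) ^ q * (1 + t) ^ m ≤ 4 ^ q * L ^ (1 - q) := by
  have hS0 : 0 < S := by linarith
  have hL0 : 0 < L := by rw [hL]; exact Real.log_pos (by nlinarith)
  have h1 : ∫ t in 0..S, (4 / ((1 + t) * L)) ^ q * (1 + t) ^ m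
      = ∫ t in 0..S, 4 ^ q * L ^ (-q) * (1 + t)⁻¹ := by
    refine intervalIntegral.integral_congr fun t ht => ?_
    rw [Set.uIcc_of_le hS0.le] at ht
    have ht0 : 0 < 1 + t := by linarith [ht.1]
    rw [Real.div_rpow (by norm_num) (by positivity), Real.mul_rpow ht0.le hL0.le,
      Real.rpow_neg hL0.le, hm, Real.rpow_sub_one ht0.ne']
    field_simp
  have h2 : ∫ t in 0..S, (1 + t)⁻¹ = Real.log (1 + S) := by
    rw [intervalIntegral.integral_comp_add_left (fun x => x⁻¹) 1, integral_inv_of_pos (by norm_num)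
      (by linarith)]
    simp
  rw [h1, intervalIntegral.integral_const_mul, h2]
  have h3 : Real.log (1 + S) ≤ L := by
    rw [hL]; exact Real.log_le_log (by linarith) (by nlinarith)
  calc 4 ^ q * L ^ (-q) * Real.log (1 + S) ≤ 4 ^ q * L ^ (-q) * L := by gcongr
    _ = 4 ^ q * L ^ (1 - q) := by
      rw [mul_assoc, show (1 : ℝ) - q = -q + 1 by ring, Real.rpow_add_one hL0.ne']

lemma le_mul_rpow_of_mul_le {ε c A x α : ℝ} (hε : 0 < ε) (hc : 0 < c) (hA : 0 < A) (hx : 0 < x)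
    (hα : 0 < α) (h : ε * c ≤ A * x ^ (-α)) : x ≤ (A / c) ^ α⁻¹ * ε ^ (-α⁻¹) := by
  have h1 : x ^ α ≤ A / c * ε⁻¹ := by
    rw [Real.rpow_neg hx.le] at h
    have hxp : 0 < x ^ α := Real.rpow_pos_of_pos hx α
    rw [← div_eq_mul_inv, div_div, le_div_iff₀ (by positivity)]
    rw [← div_eq_mul_inv, le_div_iff₀ hxp] at h
    linarith
  calc x = (x ^ α) ^ α⁻¹ := (Real.rpow_rpow_inv hx.le hα.ne').symm
    _ ≤ (A / c * ε⁻¹) ^ α⁻¹ := Real.rpow_le_rpow (by positivity) h1 (by positivity)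
    _ = _ := by
      rw [Real.mul_rpow (by positivity) (by positivity), Real.inv_rpow hε.le,
        Real.rpow_neg hε.le]

lemma hasDerivAt_log_one_add_sq (t : ℝ) :
    HasDerivAt (fun t : ℝ => Real.log (1 + t ^ 2)) (2 * t / (1 + t ^ 2)) t := by
  have h1 : HasDerivAt (fun t : ℝ => 1 + t ^ 2) (2 * t) t := by
    simpa using (hasDerivAt_pow 2 t).const_add 1
  exact h1.log (by positivity)

lemma hasDerivAt_two_mul_div_one_add_sq (t : ℝ) :
    HasDerivAt (fun t : ℝ => 2 * t / (1 + t ^ 2)) ((2 - 2 * t ^ 2) / (1 + t ^ 2) ^ 2) t := by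
  have h1 : HasDerivAt (fun t : ℝ => 1 + t ^ 2) (2 * t) t := by
    simpa using (hasDerivAt_pow 2 t).const_add 1
  have h2 : HasDerivAt (fun t : ℝ => 2 * t) 2 t := by
    simpa using (hasDerivAt_id t).const_mul 2
  refine (h2.fun_div h1 (by positivity)).congr_deriv ?_
  congr 1; ring

lemma sub_half_pos_of_lt_glasseyExponent {n : ℕ} (hn : 1 ≤ n) {p : ℝ} (hp : 1 < p)
    (h : (p : EReal) < glasseyExponent n) : 0 < 1 / (p - 1) - ((n : ℝ) - 1) / 2 := by
  have hp1 : 0 < p - 1 := by linarith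
  unfold glasseyExponent at h
  split_ifs at h with h1
  · obtain rfl : n = 1 := le_antisymm h1 hn
    simpa using hp
  · have hn1 : (0 : ℝ) < n - 1 := by
      have : (1 : ℝ) < n := by exact_mod_cast not_le.1 h1
      linarith
    rw [EReal.coe_lt_coe_iff, lt_div_iff₀ hn1] at h
    rw [sub_pos, lt_div_iff₀ hp1]
    linarith

lemma half_eq_of_eq_glasseyExponent {n : ℕ} {p : ℝ} (hp : 1 < p)
    (h : (p : EReal) = glasseyExponent n) : ((n : ℝ) - 1) / 2 = 1 / (p - 1) := by
  have hp1 : 0 < p - 1 := by linarith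
  unfold glasseyExponent at h
  split_ifs at h with h1
  · exact absurd h (EReal.coe_ne_top p)
  · have hn1 : (0 : ℝ) < n - 1 := by
      have : (1 : ℝ) < n := by exact_mod_cast not_le.1 h1
      linarith
    rw [EReal.coe_eq_coe_iff, eq_div_iff hn1.ne'] at h
    rw [eq_div_iff hp1.ne']
    linarith

lemma setIntegral_closedBall_pos {n : ℕ} {g : L2 n} (hg0 : ∀ᵐ x : Rn n, 0 ≤ g x)
    (hg : ¬ ∀ᵐ x : Rn n, g x = 0) (hgs : ∀ᵐ x : Rn n, 1 < ‖x‖ → g x = 0) :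
    0 < ∫ x in Metric.closedBall (0 : Rn n) 1, g x := by
  have hgl : LocallyIntegrable (g : Rn n → ℝ) := (Lp.memLp g).locallyIntegrable (by norm_num)
  refine lt_of_le_of_ne (integral_nonneg_of_ae (ae_restrict_of_ae hg0)) fun h => hg ?_
  have h1 := (integral_eq_zero_iff_of_nonneg_ae (ae_restrict_of_ae hg0)
    (hgl.integrableOn_isCompact (isCompact_closedBall _ _))).1 h.symm
  rw [Filter.EventuallyEq, ae_restrict_iff' Metric.isClosed_closedBall.measurableSet] at h1
  filter_upwards [h1, hgs] with x hx1 hx2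
  rcases le_or_gt ‖x‖ 1 with hx | hx
  · exact hx1 (by simpa using hx)
  · exact hx2 hx

/-! ### Lifespan bounds in the subcritical and critical cases. -/

theorem theorem2p3 (n : ℕ) (hn : 1 ≤ n) (μ β p : ℝ) (hμ : 0 < μ) (hβ : 2 < β)
    (hp : 1 < p) (hpG : (p : EReal) ≤ glasseyExponent n)
    (f : H1 n) (g : L2 n)
    (hf_nonneg : ∀ᵐ x : Rn n, 0 ≤ H1.fn f x) (hg_nonneg : ∀ᵐ x : Rn n, 0 ≤ g x)
    (hf_ne : ¬ ∀ᵐ x : Rn n, H1.fn f x = 0) (hg_ne : ¬ ∀ᵐ x : Rn n, g x = 0)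
    (hf_supp : ∀ᵐ x : Rn n, 1 < ‖x‖ → H1.fn f x = 0)
    (hg_supp : ∀ᵐ x : Rn n, 1 < ‖x‖ → g x = 0) :
    ∃ ε₀ > (0 : ℝ), ∃ C > (0 : ℝ), ∀ ε : ℝ, 0 < ε → ε ≤ ε₀ →
      ∀ T > (0 : ℝ), ∀ u : ℝ → H1 n,
        IsEnergySolution μ β p f g ε T u → HasConeSupport T u →
          ((p : EReal) < glasseyExponent n →
            T ≤ C * ε ^ (-(1 / (p - 1) - ((n : ℝ) - 1) / 2)⁻¹)) ∧
          ((p : EReal) = glasseyExponent n →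
            T ≤ Real.exp (C * ε ^ (-(p - 1)))) := by
  have hpq : p.HolderConjugate (p / (p - 1)) := Real.HolderConjugate.conjExponent hp
  set q : ℝ := p / (p - 1) with hq
  have hp1 : 0 < p - 1 := by linarith
  have hq1 : q - 1 = 1 / (p - 1) := by rw [hq]; field_simp; ring
  set m : ℝ := ((n : ℝ) - 1) / 2 with hm
  have hm0 : 0 ≤ m := by
    have : (1 : ℝ) ≤ n := by exact_mod_cast hn
    rw [hm]; linarith
  obtain ⟨C, hC, hmain⟩ := exists_lifespan_inequality hn hμ hβ hpq
  set c : ℝ := ∫ x in Metric.closedBall (0 : Rn n) 1, g x with hc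
  have hc0 : 0 < c := setIntegral_closedBall_pos hg_nonneg hg_ne hg_supp
  rcases hpG.lt_or_eq with hlt | heq
  · set α : ℝ := 1 / (p - 1) - m with hα
    have hα0 : 0 < α := sub_half_pos_of_lt_glasseyExponent hn hp hlt
    set A : ℝ := (C * 2 ^ m / c) ^ α⁻¹ with hA
    -- With `ε ≤ 1` and a constant at least `1`, the claimed bound is at least `1`; any `S` beyond
    -- it then satisfies `S ≥ 1`.
    refine ⟨1, one_pos, max A 1, lt_max_of_lt_right one_pos, fun ε hε hε1 T hT u hu hcone =>
      ⟨fun _ => ?_, fun h => absurd h hlt.ne⟩⟩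
    by_contra! hbig
    obtain ⟨S, hS1, hST⟩ := exists_between hbig
    have hε' : 1 ≤ ε ^ (-α⁻¹) :=
      Real.one_le_rpow_of_pos_of_le_one_of_nonpos hε hε1 (by simpa using hα0.le)
    have hSone : 1 ≤ S := le_trans (one_le_mul_of_one_le_of_one_le (le_max_right A 1) hε') hS1.le
    have hS0 : 0 < S := by linarith
    have hd1 : deriv (fun t : ℝ => t / S) = fun _ => 1 / S := by
      funext t; simp
    have hineq := hmain f g hf_nonneg hg_nonneg hf_supp ε hε T u hu hcone S hS0 hST
      (fun t => t / S) (fun _ => 1 / S) (contDiff_id.div_const S) (by simp)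
      (fun t ht => ⟨div_nonneg ht.1 hS0.le, (div_le_one hS0).2 ht.2⟩)
      (fun t ht => (one_le_div hS0).2 ht)
      (fun t _ => by
        rw [hd1]
        have h1 : 1 / S ≤ 1 := (div_le_one hS0).2 hSone
        refine ⟨by positivity, le_rfl, ?_, by linarith⟩
        simp only [deriv_const, abs_zero]
        positivity)
      continuousOn_const (fun _ _ => by positivity)
    have h2 : ε * c ≤ C * 2 ^ m * S ^ (-α) := by
      refine hineq.trans ?_
      rw [mul_assoc]
      refine mul_le_mul_of_nonneg_left ((integral_linear_weight_le hSone hm0).trans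
        (le_of_eq ?_)) hC.le
      congr 2
      rw [hα, ← hq1]; ring
    have h3 := le_mul_rpow_of_mul_le hε hc0 (by positivity) hS0 hα0 h2
    have h4 : A * ε ^ (-α⁻¹) ≤ max A 1 * ε ^ (-α⁻¹) := by
      gcongr; exact le_max_left _ _
    linarith
  · have hmq : m = q - 1 := by rw [hq1]; exact half_eq_of_eq_glasseyExponent hp heq
    set A : ℝ := (C * 4 ^ q / c) ^ (p - 1) with hA
    -- Here the exponent is at least `1`, so `S ≥ 2` and therefore `L ≥ 1`.
    refine ⟨1, one_pos, max A 1, lt_max_of_lt_right one_pos, fun ε hε hε1 T hT u hu hcone =>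
      ⟨fun h => absurd heq h.ne, fun _ => ?_⟩⟩
    by_contra! hbig
    obtain ⟨S, hS1, hST⟩ := exists_between hbig
    have hε' : 1 ≤ ε ^ (-(p - 1)) :=
      Real.one_le_rpow_of_pos_of_le_one_of_nonpos hε hε1 (by linarith)
    have hS2 : 2 ≤ S := by
      have h1 : (1 : ℝ) ≤ max A 1 * ε ^ (-(p - 1)) :=
        one_le_mul_of_one_le_of_one_le (le_max_right A 1) hε'
      linarith [Real.add_one_le_exp (max A 1 * ε ^ (-(p - 1)))]
    have hS0 : 0 < S := by linarith
    set L : ℝ := Real.log (1 + S ^ 2) with hL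
    have hL1 : 1 ≤ L := by
      rw [hL, Real.le_log_iff_exp_le (by positivity)]
      nlinarith [Real.exp_one_lt_d9]
    have hL0 : 0 < L := by linarith
    have hd1 : deriv (fun t : ℝ => Real.log (1 + t ^ 2) / L)
        = fun t => 2 * t / (1 + t ^ 2) / L := by
      funext t; exact ((hasDerivAt_log_one_add_sq t).div_const L).deriv
    have hd2 : deriv (fun t : ℝ => 2 * t / (1 + t ^ 2) / L)
        = fun t => (2 - 2 * t ^ 2) / (1 + t ^ 2) ^ 2 / L := by
      funext t; exact ((hasDerivAt_two_mul_div_one_add_sq t).div_const L).deriv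
    -- `log (1 + t²)` replaces `log (1 + t)` because it is smooth on all of `ℝ`. The `4` in `w`
    -- bounds both its first and second derivatives by `4 / (1 + t)`.
    have hineq := hmain f g hf_nonneg hg_nonneg hf_supp ε hε T u hu hcone S hS0 hST
      (fun t => Real.log (1 + t ^ 2) / L) (fun t => 4 / ((1 + t) * L))
      ((ContDiff.log (by fun_prop) fun t => by positivity).div_const L) (by simp)
      (fun t ht => ⟨div_nonneg (Real.log_nonneg (by nlinarith [sq_nonneg t])) hL0.le,
        (div_le_one hL0).2 (Real.log_le_log (by positivity) (by
          have := ht.1; have := ht.2; gcongr))⟩)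
      (fun t ht => (one_le_div hL0).2 (Real.log_le_log (by positivity) (by gcongr)))
      (fun t ht => by
        have ht0 : 0 < t := ht.1
        rw [hd1, hd2]
        beta_reduce
        rw [← div_div 4]
        refine ⟨by positivity, ?_, ?_, ?_⟩
        · refine div_le_div_of_nonneg_right ?_ hL0.le
          rw [div_le_div_iff₀ (by positivity) (by positivity)]
          nlinarith [sq_nonneg (t - 1)]
        · rw [abs_div, abs_of_pos hL0]
          refine div_le_div_of_nonneg_right ?_ hL0.le
          rw [abs_div, abs_of_pos (show 0 < (1 + t ^ 2) ^ 2 by positivity)]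
          have h1 : |2 - 2 * t ^ 2| ≤ 2 * (1 + t ^ 2) :=
            abs_le.2 ⟨by linarith, by nlinarith⟩
          calc |2 - 2 * t ^ 2| / (1 + t ^ 2) ^ 2 ≤ 2 * (1 + t ^ 2) / (1 + t ^ 2) ^ 2 := by gcongr
            _ = 2 / (1 + t ^ 2) := by field_simp
            _ ≤ 4 / (1 + t) := by
              rw [div_le_div_iff₀ (by positivity) (by positivity)]
              nlinarith [sq_nonneg (t - 1)]
        · rw [div_div, div_le_iff₀ (by positivity)]
          nlinarith)
      (continuousOn_const.div (by fun_prop) fun t ht => by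
        have := ht.1; positivity)
      (fun t ht => by have := ht.1; positivity)
    have h2 : ε * c ≤ C * 4 ^ q * L ^ (-(1 / (p - 1))) := by
      refine hineq.trans ?_
      rw [mul_assoc]
      refine mul_le_mul_of_nonneg_left ((integral_log_weight_le (by linarith) hL hmq).trans
        (le_of_eq ?_)) hC.le
      congr 2
      rw [← hq1]; ring
    have h3 := le_mul_rpow_of_mul_le hε hc0 (by positivity) hL0 (one_div_pos.2 hp1) h2
    rw [one_div, inv_inv] at h3
    have h4 : A * ε ^ (-(p - 1)) ≤ max A 1 * ε ^ (-(p - 1)) := by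
      gcongr; exact le_max_left _ _
    have h5 : S ≤ Real.exp L := by
      rw [hL, Real.exp_log (by positivity)]; nlinarith
    have h6 : Real.exp L ≤ Real.exp (max A 1 * ε ^ (-(p - 1))) := Real.exp_le_exp.2 (h3.trans h4)
    linarith
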